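/- Let $(S_x)_{x\ge 0}$ be a continuous-time Markov chain on $\{1,\dots,M\}$ with generator $Q=(q_{ij})$, $q_i:=-q_{ii}=\sum_{j\ne i}q_{ij}$, and initial distribution $\xi_0=(\xi_0^i)_i$. Let $0=t_0<t_1<t_2<\cdots$ be the event times of a Markov-modulated Hawkes process (MMHP) driven by $S$, with baselines $\mu^i\ge 0$ and non-negative measurable kernels $\phi^i$ that are locally integrable on $[0,\infty)$. That is, conditionally on the whole chain $S$ and on the past events, the next event has hazard rate $$\lambda_x=\sum_{i=1}^M \mathbf 1_{\{S_x=i\}}\lambda^i_x,\qquad \lambda^i_x=\mu^i+\sum_{t_k<x}\phi^i(x-t_k).$$ Fix $K$ and observe the process on $[0,T]$ with $T=t_K$. The complete data are the event times $t_1<\dots<t_K=T$ together with the hidden path of $S$ on $[0,T]$, given by its number of jumps $m$, its successive states $s_1,\dots,s_{m+1}$ and its jump times $0<u_1<\dots<u_m<T$; put $u_0=0$, $u_{m+1}=T$. The reference measure on complete data is the counting measure for $m$ and $(s_p)_p$ times the Lebesgue measure for $(u_p)_p$ and $(t_n)_n$, restricted to the data with $0<t_1<\dots<t_K$, $0<u_1<\dots<u_m<t_K$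 and $s_p\ne s_{p+1}$ for all $p$. Then the law of the complete data (on the event that there are at least $K$ events) is absolutely continuous with respect to the reference measure, and its log-density, the complete log-likelihood, is for almost every complete datum (with $\log 0=-\infty$ and $0\cdot(-\infty)=0$) equal to $\log\mathcal L^M+\log\mathcal L^H$, where $$\log\mathcal L^M=\sum_{i=1}^M\Big\{\mathbf 1_{\{S_0=i\}}\log\xi_0^i-D_iq_i+\sum_{j\ne i}w_{ij}\log q_{ij}\Big\},$$ $$\log\mathcal L^H=\sum_{i=1}^M\Big\{\sum_{n=1}^K\mathbf 1_{\{S_{t_n}=i\}}\log\lambda^i_{t_n}-\int_0^T\mathbf 1_{\{S_x=i\}}\lambda^i_x\,dx\Big\}.$$ Here $D_i=\int_0^T\mathbf 1_{\{S_x=i\}}dx$ is the time spent in state $i$ and $w_{ij}=\sum_{p=1}^m\mathbf 1_{\{s_p=i,\,s_{p+1}=j\}}$ is the number of jumps from $i$ to $j$. Moreover, for every complete datum, $$D_i=\sum_{p=1}^{m+1}\mathbf 1_{\{s_p=i\}}(u_p-u_{p-1})\quad\text{for all } i,\qquad w_{ij}=\lim_{\Delta\to0^+}\frac1\Delta\int_\Delta^T\mathbf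 1_{\{S_{x-\Delta}=i,\,S_x=j\}}dx\quad\text{for } i\ne j.$$ -/

import Mathlib

open MeasureTheory

open scoped ENNReal NNReal

namespace MMHP

noncomputable section

/-- Parameters of an `M`-state Markov-modulated Hawkes process: the initial distribution `ξ`, the
infinitesimal generator `Q` of the hidden chain, and for each state `i` the baseline `μ i` and the
non-negative, locally integrable kernel `φ i` (only its values on `(0, ∞)` matter). -/
structure Params (M : ℕ) where
  ξ : Fin M → ℝ
  Q : Matrix (Fin M) (Fin M) ℝ
  μ : Fin M → ℝ
  φ : Fin M → ℝ → ℝ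
  ξ_nonneg : ∀ i, 0 ≤ ξ i
  ξ_sum : ∑ i, ξ i = 1
  Q_nonneg : ∀ i j, i ≠ j → 0 ≤ Q i j
  Q_row_sum : ∀ i, ∑ j, Q i j = 0
  μ_nonneg : ∀ i, 0 ≤ μ i
  φ_nonneg : ∀ i x, 0 < x → 0 ≤ φ i x
  φ_measurable : ∀ i, Measurable (φ i)
  φ_integrable : ∀ i x, IntegrableOn (φ i) (Set.Ioc 0 x)

variable {M : ℕ}

/-- The total exit rate `q i = -q i i = ∑_{j ≠ i} q i j`. -/
def Params.q (θ : Params M) (i : Fin M) : ℝ := -θ.Q i i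

/-- The transition matrix of the embedded jump chain: `q i j / q i` off the diagonal, with an
absorbing state (`q i = 0`) staying where it is. -/
def Params.jumpMatrix (θ : Params M) (i j : Fin M) : ℝ :=
  if i = j then (if θ.q i = 0 then 1 else 0) else θ.Q i j / θ.q i

/-- The intensity `λ^i_x = μ^i + ∑_{t_k < x} φ^i (x - t_k)` of state `i` at time `x`, given the
event times `t_1, …, t_n`. -/
def Params.stateIntensity (θ : Params M) {n : ℕ} (t : Fin n → ℝ) (i : Fin M) (x : ℝ) : ℝ :=
  θ.μ i + ∑ k, if t k < x then θ.φ i (x - t k) else 0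

/-- The intensity `λ_x = ∑_i 1{s_x = i} λ^i_x` at time `x`, given a path `s` of the hidden chain and
the event times `t_1, …, t_n`. -/
def Params.intensity (θ : Params M) (s : ℝ → Fin M) {n : ℕ} (t : Fin n → ℝ) (x : ℝ) : ℝ :=
  ∑ i, if s x = i then θ.stateIntensity t i x else 0

/-! ### The process -/

section Model

variable {Ω : Type*}

/-- The `p`-th jump time of a chain with holding times `W 0, W 1, …` (with `jumpTime W 0 = 0`). -/
def jumpTime (W : ℕ → Ω → ℝ≥0∞) (p : ℕ) (ω : Ω) : ℝ≥0∞ := ∑ k ∈ Finset.range p, W k ω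

/-- The σ-algebra generated by the whole hidden chain, through its jump chain `Y` and its holding
times `W`. -/
abbrev chainHistory (Y : ℕ → Ω → Fin M) (W : ℕ → Ω → ℝ≥0∞) : MeasurableSpace Ω :=
  ⨆ k, (MeasurableSpace.comap (Y k) inferInstance ⊔ MeasurableSpace.comap (W k) inferInstance)

/-- The σ-algebra generated by the whole hidden chain and the event times `T 0 = 0, …, T n`. -/
abbrev history (Y : ℕ → Ω → Fin M) (W T : ℕ → Ω → ℝ≥0∞) (n : ℕ) : MeasurableSpace Ω :=
  chainHistory Y W ⊔ ⨆ k ∈ Finset.range (n + 1), MeasurableSpace.comap (T k) inferInstance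

variable [MeasurableSpace Ω]

/-- `S` is a continuous-time Markov chain on `Fin M` with generator `Q` and initial distribution
`ξ`, with jump chain `Y` and holding times `W`: `Y` is a discrete-time Markov chain with initial
distribution `ξ` and transition matrix `jumpMatrix`, and conditionally on `Y` the holding times are
independent, `W k` being exponential of rate `q (Y k)` (infinite if this rate is `0`). -/
structure IsMarkovChain (θ : Params M) (P : Measure Ω) (S : ℝ → Ω → Fin M)
    (Y : ℕ → Ω → Fin M) (W : ℕ → Ω → ℝ≥0∞) : Prop where
  measurable_S : ∀ x, 0 ≤ x → Measurable (S x)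
  measurable_Y : ∀ k, Measurable (Y k)
  measurable_W : ∀ k, Measurable (W k)
  law : ∀ (p : ℕ) (i : Fin (p + 1) → Fin M) (x : Fin (p + 1) → ℝ≥0),
    P {ω | ∀ k : Fin (p + 1), Y k ω = i k ∧ (x k : ℝ≥0∞) < W k ω} =
      ENNReal.ofReal (θ.ξ (i 0) * (∏ k : Fin p, θ.jumpMatrix (i k.castSucc) (i k.succ)) *
        ∏ k : Fin (p + 1), Real.exp (-θ.q (i k) * x k))
  path : ∀ᵐ ω ∂P, ∀ (p : ℕ) (x : ℝ), 0 ≤ x → jumpTime W p ω ≤ ENNReal.ofReal x →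
    ENNReal.ofReal x < jumpTime W (p + 1) ω → S x ω = Y p ω

/-- The point process with occurrence times `T 1 < T 2 < …` (in `(0, ∞]`, with the convention
`T 0 = 0`, and `T n = ∞` if there are fewer than `n` events) modulated by the Markov chain `S` is a
Markov-modulated Hawkes process: `λ` is its conditional intensity. That is, given the hidden chain
and the first `n` event times, the next event time has the hazard rate
`λ_y = ∑_i 1{S_y = i} (μ^i + ∑_{t_k < y} φ^i (y - t_k))`. -/
structure IsMMHP (θ : Params M) (P : Measure Ω) (S : ℝ → Ω → Fin M)
    (Y : ℕ → Ω → Fin M) (W : ℕ → Ω → ℝ≥0∞) (T : ℕ → Ω → ℝ≥0∞) : Prop where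
  chain : IsMarkovChain θ P S Y W
  measurable_T : ∀ n, Measurable (T n)
  T_zero : ∀ ω, T 0 ω = 0
  T_increasing : ∀ᵐ ω ∂P, ∀ n, T n ω ≤ T (n + 1) ω ∧ (T n ω < ∞ → T n ω < T (n + 1) ω)
  hazard : ∀ (n : ℕ) (x : ℝ≥0), ∀ᵐ ω ∂P, T n ω < ∞ →
    condExp (history Y W T n) P
        ({ω' | T n ω' + x < T (n + 1) ω'}.indicator fun _ => (1 : ℝ)) ω =
      Real.exp (-∫ y in (T n ω).toReal..((T n ω).toReal + x),
        θ.intensity (fun z => S z ω) (fun k : Fin n => (T (k + 1) ω).toReal) y)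

end Model

/-! ### Complete data -/

/-- A piecewise constant path with `m` jumps: its successive states `s_1, …, s_{m+1}` and its jump
times `u_1, …, u_m`. -/
abbrev HiddenPath (M : ℕ) : Type := Σ m : ℕ, (Fin (m + 1) → Fin M) × (Fin m → ℝ)

/-- Complete data: the hidden path up to the last event, and the event times `t_1, …, t_K`. -/
abbrev CompleteData (M K : ℕ) : Type := HiddenPath M × (Fin K → ℝ)

variable {K : ℕ}

namespace CompleteData

/-- The number of jumps of the hidden path. -/
abbrev m (c : CompleteData M K) : ℕ := c.1.1

/-- The successive states of the hidden path. -/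
abbrev s (c : CompleteData M K) : Fin (c.m + 1) → Fin M := c.1.2.1

/-- The jump times of the hidden path. -/
abbrev u (c : CompleteData M K) : Fin c.m → ℝ := c.1.2.2

/-- The event times. -/
abbrev t (c : CompleteData M K) : Fin K → ℝ := c.2

/-- The end `T = t_K` of the observation window (with `t_0 = 0`). -/
def horizon (c : CompleteData M K) : ℝ :=
  if h : 0 < K then c.t ⟨K - 1, Nat.sub_lt h Nat.one_pos⟩ else 0

/-- `0 < t_1 < … < t_K = T`, `0 < u_1 < … < u_m < T`, and every jump changes the state. -/
def Valid (c : CompleteData M K) : Prop :=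
  (∀ n, 0 < c.t n) ∧ StrictMono c.t ∧ (∀ p, 0 < c.u p ∧ c.u p < c.horizon) ∧ StrictMono c.u ∧
    ∀ p : Fin c.m, c.s p.castSucc ≠ c.s p.succ

/-- The number of jumps of the hidden path up to time `x`. -/
def jumpsUpTo (c : CompleteData M K) (x : ℝ) : ℕ := {p : Fin c.m | c.u p ≤ x}.ncard

theorem jumpsUpTo_lt (c : CompleteData M K) (x : ℝ) : c.jumpsUpTo x < c.m + 1 := by
  have h := Set.ncard_le_ncard (Set.subset_univ {p : Fin c.m | c.u p ≤ x})
  rw [Set.ncard_univ, Nat.card_fin] at h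
  exact Nat.lt_succ_of_le h

/-- The state `S_x` of the hidden path at time `x` (right-continuous). -/
def state (c : CompleteData M K) (x : ℝ) : Fin M := c.s ⟨c.jumpsUpTo x, c.jumpsUpTo_lt x⟩

/-- The time `D_i` that the hidden path spends in state `i` over `[0, T]`. -/
def occupation (c : CompleteData M K) (i : Fin M) : ℝ :=
  ∫ x in (0 : ℝ)..c.horizon, if c.state x = i then 1 else 0

/-- The number `w_ij` of jumps of the hidden path from `i` to `j` over `[0, T]`. -/
def transitions (c : CompleteData M K) (i j : Fin M) : ℕ :=
  {p : Fin c.m | c.s p.castSucc = i ∧ c.s p.succ = j}.ncard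

end CompleteData

/-- Logarithm of a non-negative real number, with `log 0 = -∞`. -/
def elog (x : ℝ) : EReal := ENNReal.log (ENNReal.ofReal x)

/-- The Markov part of the complete log-likelihood (with `0 · (-∞) = 0`). -/
def logLikelihoodMarkov (θ : Params M) (c : CompleteData M K) : EReal :=
  ∑ i, ((if c.state 0 = i then elog (θ.ξ i) else 0) - ((c.occupation i * θ.q i : ℝ) : EReal) +
    ∑ j ∈ Finset.univ.erase i, ((c.transitions i j : ℝ) : EReal) * elog (θ.Q i j))

/-- The Hawkes part of the complete log-likelihood. -/
def logLikelihoodHawkes (θ : Params M) (c : CompleteData M K) : EReal :=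
  ∑ i, ((∑ n, if c.state (c.t n) = i then elog (θ.stateIntensity c.t i (c.t n)) else 0) -
    ((∫ x in (0 : ℝ)..c.horizon,
      if c.state x = i then θ.stateIntensity c.t i x else 0 : ℝ) : EReal))

/-- The natural reference measure on complete data: counting measure for the number of jumps and
the states, Lebesgue measure for the jump times and the event times. -/
def referenceMeasure (M K : ℕ) : Measure (CompleteData M K) :=
  ((Measure.sum fun m : ℕ =>
    Measure.map (fun z => (⟨m, z⟩ : HiddenPath M))
      ((Measure.count : Measure (Fin (m + 1) → Fin M)).prod
        (volume : Measure (Fin m → ℝ)))).prod (volume : Measure (Fin K → ℝ))).restrict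
    {c : CompleteData M K | c.Valid}

section Likelihood

variable {Ω : Type*}

/-- The complete data of a trajectory observed up to its `K`-th event: the path of the hidden chain
on `[0, T K]` and the event times `T 1, …, T K`. -/
def completeData (K : ℕ) (Y : ℕ → Ω → Fin M) (W T : ℕ → Ω → ℝ≥0∞) (ω : Ω) : CompleteData M K :=
  (⟨{p : ℕ | jumpTime W (p + 1) ω ≤ T K ω}.ncard,
    fun p => Y p ω, fun p => (jumpTime W (p + 1) ω).toReal⟩,
    fun n => (T (n + 1) ω).toReal)

variable [MeasurableSpace Ω]

/-- The law of the complete data, on the event that there are at least `K` events. -/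
def completeLaw (K : ℕ) (P : Measure Ω) (Y : ℕ → Ω → Fin M) (W T : ℕ → Ω → ℝ≥0∞) :
    Measure (CompleteData M K) :=
  (P.restrict {ω | T K ω < ∞}).map (completeData K Y W T)

/-- The complete log-likelihood: the logarithm (with `log 0 = -∞`) of the density of the law of the
complete data with respect to the reference measure. -/
def completeLogLikelihood (P : Measure Ω) (Y : ℕ → Ω → Fin M) (W T : ℕ → Ω → ℝ≥0∞)
    (c : CompleteData M K) : EReal :=
  ENNReal.log ((completeLaw K P Y W T).rnDeriv (referenceMeasure M K) c)

end Likelihood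

end

end MMHP

/-!
The complete data consist of the path of the hidden chain up to the last event and of the event
times. Their law is computed in two steps, first the event times given the whole chain, then the
chain, and its density is written down explicitly.

*Event times.* Given the chain and the first `n` event times, the hazard condition says that the
next waiting time exceeds `x` with probability `exp (-∫ λ)` over a window of length `x`. The
intensity is only locally integrable, but `exp (-∫ λ)` is absolutely continuous, so the waiting time
has the density `λ exp (-∫ λ)` (`setLIntegral_hazard_density`, `lintegral_of_hazard`). By induction
on `n` the first `n` event times have, given the chain, the density `∏ λ_{t_k} · exp (-∫_0^{t_n} λ)`
(`IsMMHP.lintegral_eventTimes`, `Params.eventDensity_eq`).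

*Hidden chain.* Given the jump chain, the holding times are independent exponentials
(`IsMarkovChain.map_holdingTimes`). The rates are bounded, so jumps do not accumulate
(`IsMarkovChain.ae_nonExplosive`) and the path up to a fixed time `τ` is determined by finitely many
of them. Passing from holding times to jump times is linear with determinant `1`
(`measurePreserving_partialSums`), and the last, unfinished holding time contributes its survival
probability. The path up to `τ` thus has the density `ξ ∏ q_{ij} · exp (-∑ q_i D_i)`
(`IsMarkovChain.lintegral_pathUpTo`).

*Together.* The density of the event times given the chain depends on the chain only up to the last
event (`Params.eventDensity_congr`). By Tonelli's theorem the chain can therefore be integrated out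
up to the time `τ = t_K` with the event times fixed, and the law of the complete data has the
product of the two densities as its density (`IsMMHP.completeLaw_eq`). The two parts of the
log-likelihood are the logarithms of the two factors, grouped by states
(`CompleteData.Valid.log_completeDensity`).

The formula for the occupation times integrates over the intervals between jumps. In the limit that
counts the transitions, a window shorter than all gaps between jumps holds at most one jump, so the
integral is exactly `Δ` times the number of jumps from `i` to `j` for all small `Δ`
(`CompleteData.Valid.state_window_eq`).
-/

namespace MMHP

/-! ### Occupation times and transition counts of a path -/

section DeterministicPaths

variable {M K : ℕ}

namespace CompleteData

theorem ncard_fin_val_lt {m p : ℕ} (hp : p ≤ m) : {k : Fin m | (k : ℕ) < p}.ncard = p := by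
  have h : {k : Fin m | (k : ℕ) < p} =
      ((Finset.univ.filter fun k : Fin m => (k : ℕ) < p : Finset (Fin m)) : Set (Fin m)) := by
    ext; simp
  rw [h, Set.ncard_coe_finset, Fin.card_filter_val_lt, min_eq_right hp]

theorem jumpsUpTo_eq (c : CompleteData M K) {x : ℝ} {p : ℕ} (hp : p ≤ c.m)
    (h₁ : ∀ k : Fin c.m, (k : ℕ) < p → c.u k ≤ x) (h₂ : ∀ k : Fin c.m, p ≤ (k : ℕ) → x < c.u k) :
    c.jumpsUpTo x = p := by
  have : {k : Fin c.m | c.u k ≤ x} = {k : Fin c.m | (k : ℕ) < p} := by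
    ext k
    simp only [Set.mem_ofPred_eq]
    refine ⟨fun h => ?_, h₁ k⟩
    by_contra hk
    exact absurd (h₂ k (not_lt.mp hk)) (not_lt.mpr h)
  rw [jumpsUpTo, this, ncard_fin_val_lt hp]

theorem state_eq (c : CompleteData M K) {x : ℝ} (p : Fin (c.m + 1))
    (h₁ : ∀ k : Fin c.m, k.castSucc < p → c.u k ≤ x)
    (h₂ : ∀ k : Fin c.m, p ≤ k.castSucc → x < c.u k) : c.state x = c.s p := by
  have : c.jumpsUpTo x = p := c.jumpsUpTo_eq (Nat.lt_succ_iff.mp p.2) (fun k hk => h₁ k hk)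
    (fun k hk => h₂ k hk)
  simp only [state]
  congr 1
  exact Fin.ext this

/-- The partition points `0, u_1, …, u_m, T` of the observation window. They are indexed by `ℕ` (and
equal to `T` from `m + 1` on) so that integrals over adjacent intervals can be summed. -/
noncomputable def node (c : CompleteData M K) (k : ℕ) : ℝ :=
  if k = 0 then 0 else if h : k - 1 < c.m then c.u ⟨k - 1, h⟩ else c.horizon

theorem node_castSucc (c : CompleteData M K) (p : Fin (c.m + 1)) :
    c.node p = (Fin.cons 0 c.u : Fin (c.m + 1) → ℝ) p := by
  refine Fin.cases ?_ (fun k => ?_) p <;> simp [node]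

theorem node_succ (c : CompleteData M K) (p : Fin (c.m + 1)) :
    c.node (p + 1) = (Fin.snoc c.u c.horizon : Fin (c.m + 1) → ℝ) p := by
  refine Fin.lastCases ?_ (fun k => ?_) p <;> simp [node]

theorem Valid.horizon_nonneg {c : CompleteData M K} (hc : c.Valid) : 0 ≤ c.horizon := by
  unfold horizon
  split_ifs with h
  · exact (hc.1 _).le
  · exact le_rfl

theorem Valid.node_le {c : CompleteData M K} (hc : c.Valid) (p : Fin (c.m + 1)) :
    c.node p ≤ c.node (p + 1) := by
  obtain ⟨p, hp⟩ := p
  rcases Nat.eq_zero_or_pos p with rfl | h0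
  · by_cases h : 0 < c.m
    · simpa [node, h] using (hc.2.2.1 ⟨0, h⟩).1.le
    · simpa [node, h] using hc.horizon_nonneg
  · have h1 : p - 1 < c.m := by omega
    by_cases h : p < c.m
    · simpa [node, h, h1, h0.ne'] using (hc.2.2.2.1 (show (⟨p - 1, h1⟩ : Fin c.m) < ⟨p, h⟩ by
        simp [Fin.lt_def]; omega)).le
    · simpa [node, h, h1, h0.ne'] using (hc.2.2.1 ⟨p - 1, h1⟩).2.le

theorem Valid.state_of_mem_Ioo {c : CompleteData M K} (hc : c.Valid) (p : Fin (c.m + 1)) {x : ℝ}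
    (hx : x ∈ Set.Ioo (c.node p) (c.node (p + 1))) : c.state x = c.s p := by
  refine c.state_eq p (fun k hk => ?_) (fun k hk => ?_)
  · rw [node_castSucc] at hx
    obtain ⟨j, rfl⟩ := Fin.exists_succ_eq.mpr (Fin.ne_zero_of_lt hk)
    rw [Fin.cons_succ] at hx
    exact (hc.2.2.2.1.monotone (Fin.castSucc_lt_succ_iff.mp hk)).trans hx.1.le
  · rw [node_succ] at hx
    obtain ⟨j, rfl⟩ := Fin.exists_castSucc_eq.mpr (ne_of_lt (hk.trans_lt (Fin.castSucc_lt_last k)))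
    rw [Fin.snoc_castSucc] at hx
    exact hx.2.trans_le (hc.2.2.2.1.monotone (Fin.castSucc_le_castSucc_iff.mp hk))

theorem Valid.occupation_eq {c : CompleteData M K} (hc : c.Valid) (i : Fin M) :
    c.occupation i = ∑ p : Fin (c.m + 1), if c.s p = i then
      (Fin.snoc c.u c.horizon : Fin (c.m + 1) → ℝ) p - (Fin.cons 0 c.u : Fin (c.m + 1) → ℝ) p
      else 0 := by
  have hpiece : ∀ p : Fin (c.m + 1), Set.EqOn (fun _ => if c.s p = i then (1 : ℝ) else 0)
      (fun x => if c.state x = i then (1 : ℝ) else 0) (Set.Ioo (c.node p) (c.node (p + 1))) := by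
    intro p x hx
    simp only [hc.state_of_mem_Ioo p hx]
  have hint : ∀ p < c.m + 1, IntervalIntegrable (fun x => if c.state x = i then (1 : ℝ) else 0)
      volume (c.node p) (c.node (p + 1)) := by
    intro p hp
    have hle := hc.node_le ⟨p, hp⟩
    rw [intervalIntegrable_iff_integrableOn_Ioo_of_le hle]
    exact (integrableOn_congr_fun (hpiece ⟨p, hp⟩) measurableSet_Ioo).mp (by simp)
  have hsum := intervalIntegral.sum_integral_adjacent_intervals hint
  have h0 : c.node 0 = 0 := by simp [node]
  have h1 : c.node (c.m + 1) = c.horizon := by simp [node]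
  rw [h0, h1] at hsum
  rw [occupation, ← hsum, Finset.sum_range]
  refine Finset.sum_congr rfl fun p _ => ?_
  rw [intervalIntegral.integral_of_le (hc.node_le p), integral_Ioc_eq_integral_Ioo,
    ← setIntegral_congr_fun measurableSet_Ioo (hpiece p), ← integral_Ioc_eq_integral_Ioo,
    ← intervalIntegral.integral_of_le (hc.node_le p), intervalIntegral.integral_const, node_succ,
    node_castSucc]
  simp

/-- If the gaps between jumps exceed `Δ`, then a window of length `Δ` sees at most one jump, so the
state changes from `i` to `j ≠ i` across the window exactly when it holds a jump from `i` to `j`. -/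
theorem Valid.state_window_eq {c : CompleteData M K} (hc : c.Valid) {Δ : ℝ} (hΔ : 0 < Δ)
    (hgap : ∀ p k : Fin c.m, p < k → Δ < c.u k - c.u p) {i j : Fin M} (hij : i ≠ j) (x : ℝ) :
    (if c.state (x - Δ) = i ∧ c.state x = j then (1 : ℝ) else 0) =
      ∑ p : Fin c.m, if c.s p.castSucc = i ∧ c.s p.succ = j then
        (Set.Ico (c.u p) (c.u p + Δ)).indicator (fun _ => (1 : ℝ)) x else 0 := by
  by_cases h : ∃ p, x ∈ Set.Ico (c.u p) (c.u p + Δ)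
  · obtain ⟨p, hp⟩ := h
    have hlt : ∀ k, k < p → c.u k < x - Δ := fun k hk => by linarith [hgap k p hk, hp.1]
    have hgt : ∀ k, p < k → x < c.u k := fun k hk => by linarith [hgap p k hk, hp.2]
    have h1 : c.state (x - Δ) = c.s p.castSucc := by
      refine c.state_eq _ (fun k hk => (hlt k (by simpa using hk)).le) (fun k hk => ?_)
      have := hc.2.2.2.1.monotone (show p ≤ k by simpa using hk)
      linarith [hp.2]
    have h2 : c.state x = c.s p.succ := by
      refine c.state_eq _ (fun k hk => ?_) (fun k hk => hgt k ?_)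
      · exact (hc.2.2.2.1.monotone (Fin.castSucc_lt_succ_iff.mp hk)).trans hp.1
      · exact Fin.succ_le_castSucc_iff.mp hk
    rw [Finset.sum_eq_single p]
    · rw [h1, h2, Set.indicator_of_mem hp]
    · intro k _ hk
      have : x ∉ Set.Ico (c.u k) (c.u k + Δ) := by
        rintro ⟨ha, hb⟩
        rcases lt_or_gt_of_ne hk with hk | hk
        · linarith [hlt k hk]
        · linarith [hgt k hk]
      rw [Set.indicator_of_notMem this, ite_self]
    · simp
  · push Not at h
    have : c.state (x - Δ) = c.state x := by
      have : c.jumpsUpTo (x - Δ) = c.jumpsUpTo x := by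
        unfold jumpsUpTo
        congr 1
        ext k
        have := h k
        simp only [Set.mem_Ico, not_and, not_lt] at this
        exact ⟨fun hk => by simp only [Set.mem_ofPred_eq] at hk ⊢; linarith,
          fun hk => by simp only [Set.mem_ofPred_eq] at hk ⊢; linarith [this hk]⟩
      simp only [state, this]
    rw [if_neg (by rw [this]; rintro ⟨rfl, h⟩; exact hij h), Finset.sum_eq_zero]
    intro p _
    rw [Set.indicator_of_notMem (h p), ite_self]

theorem transitions_eq_card (c : CompleteData M K) (i j : Fin M) :
    c.transitions i j =
      (Finset.univ.filter fun p : Fin c.m => c.s p.castSucc = i ∧ c.s p.succ = j).card := by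
  rw [transitions, ← Set.ncard_coe_finset]
  simp

theorem Valid.tendsto_transitions {c : CompleteData M K} (hc : c.Valid) {i j : Fin M}
    (hij : i ≠ j) :
    Filter.Tendsto
      (fun Δ : ℝ => 1 / Δ * ∫ x in Δ..c.horizon,
        if c.state (x - Δ) = i ∧ c.state x = j then (1 : ℝ) else 0)
      (nhdsWithin 0 (Set.Ioi 0)) (nhds (c.transitions i j : ℝ)) := by
  have hsmall : ∀ a : ℝ, 0 < a → ∀ᶠ Δ in nhdsWithin (0 : ℝ) (Set.Ioi 0), Δ < a := fun a ha =>
    mem_nhdsWithin_of_mem_nhds (Iio_mem_nhds ha)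
  have hgap : ∀ᶠ Δ in nhdsWithin (0 : ℝ) (Set.Ioi 0),
      ∀ p k : Fin c.m, p < k → Δ < c.u k - c.u p := by
    simp only [Filter.eventually_all]
    intro p k hpk
    exact hsmall _ (sub_pos.mpr (hc.2.2.2.1 hpk))
  have hfirst : ∀ᶠ Δ in nhdsWithin (0 : ℝ) (Set.Ioi 0), ∀ p, Δ < c.u p :=
    Filter.eventually_all.mpr fun p => hsmall _ (hc.2.2.1 p).1
  have hlast : ∀ᶠ Δ in nhdsWithin (0 : ℝ) (Set.Ioi 0), ∀ p, Δ < c.horizon - c.u p :=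
    Filter.eventually_all.mpr fun p => hsmall _ (sub_pos.mpr (hc.2.2.1 p).2)
  -- Once `Δ` is smaller than all gaps, each jump from `i` to `j` contributes exactly `Δ`.
  refine tendsto_nhds_of_eventually_eq ?_
  filter_upwards [hgap, hfirst, hlast, self_mem_nhdsWithin] with Δ hgap hfirst hlast hΔ
  have hΔ : 0 < Δ := hΔ
  simp_rw [hc.state_window_eq hΔ hgap hij]
  have hval : ∀ p, ∫ x in Δ..c.horizon,
      (Set.Ico (c.u p) (c.u p + Δ)).indicator (fun _ => (1 : ℝ)) x = Δ := by
    intro p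
    have hle : Δ ≤ c.horizon := by linarith [hfirst p, hlast p]
    rw [intervalIntegral.integral_of_le hle, setIntegral_indicator measurableSet_Ico,
      Set.inter_eq_right.mpr]
    · simp [hΔ.le]
    · intro x hx
      exact ⟨(hfirst p).trans_le hx.1, by linarith [hx.2, hlast p]⟩
  rw [intervalIntegral.integral_finsetSum]
  · have : ∀ p : Fin c.m, ∫ x in Δ..c.horizon, (if c.s p.castSucc = i ∧ c.s p.succ = j then
        (Set.Ico (c.u p) (c.u p + Δ)).indicator (fun _ => (1 : ℝ)) x else 0) =
        if c.s p.castSucc = i ∧ c.s p.succ = j then Δ else 0 := by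
      intro p
      split_ifs
      · exact hval p
      · simp
    simp_rw [this]
    rw [← Finset.sum_filter, Finset.sum_const, transitions_eq_card, nsmul_eq_mul]
    field_simp
  · intro p _
    split_ifs
    · exact ((integrable_indicator_iff measurableSet_Ico).mpr (by simp)).intervalIntegrable
    · simp

end CompleteData

end DeterministicPaths

/-! ### Integration over finite products -/

section FiniteProducts

/-- Tonelli's theorem on `ℝⁿ`, peeling off the last coordinate. -/
theorem lintegral_pi_snoc {n : ℕ} {α : Type*} [MeasurableSpace α]
    (μ : Fin (n + 1) → Measure α) [∀ i, SigmaFinite (μ i)] {f : (Fin (n + 1) → α) → ℝ≥0∞}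
    (hf : Measurable f) :
    ∫⁻ x, f x ∂Measure.pi μ =
      ∫⁻ x, ∫⁻ y, f (Fin.snoc x y) ∂μ (Fin.last n) ∂Measure.pi fun k : Fin n => μ k.castSucc := by
  have h := (measurePreserving_piFinSuccAbove μ (Fin.last n)).symm
  rw [← h.lintegral_comp_emb (MeasurableEquiv.measurableEmbedding _), lintegral_prod_symm]
  · simp only [Fin.succAbove_last]
    refine lintegral_congr fun x => lintegral_congr fun y => ?_
    congr 1
    exact Fin.insertNth_last' y x
  · exact (hf.comp (MeasurableEquiv.measurable _)).aemeasurable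

theorem lintegral_pi_prod_eq_prod_lintegral {n : ℕ} {α : Type*} [MeasurableSpace α]
    (μ : Fin n → Measure α) [∀ i, SigmaFinite (μ i)] {f : Fin n → α → ℝ≥0∞}
    (hf : ∀ k, Measurable (f k)) :
    ∫⁻ x, ∏ k, f k (x k) ∂Measure.pi μ = ∏ k, ∫⁻ y, f k y ∂μ k := by
  induction n with
  | zero => simp
  | succ n ih =>
    rw [lintegral_pi_snoc μ (by fun_prop)]
    simp only [Fin.prod_univ_castSucc, Fin.snoc_castSucc, Fin.snoc_last]
    simp_rw [lintegral_const_mul _ (hf (Fin.last n))]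
    rw [lintegral_mul_const _ (by fun_prop), ih (fun k => μ k.castSucc) fun k => hf k.castSucc]

/-- A product of measures with densities has the product of the densities as its density. -/
theorem pi_withDensity {n : ℕ} {α : Type*} [MeasurableSpace α]
    (μ : Fin n → Measure α) [∀ i, SigmaFinite (μ i)] {f : Fin n → α → ℝ≥0∞}
    (hf : ∀ k, Measurable (f k)) [∀ k, SigmaFinite ((μ k).withDensity (f k))] :
    Measure.pi (fun k => (μ k).withDensity (f k)) =
      (Measure.pi μ).withDensity fun x => ∏ k, f k (x k) := by
  refine Measure.pi_eq fun s hs => ?_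
  rw [withDensity_apply _ (MeasurableSet.univ_pi hs), Measure.restrict_pi_pi,
    lintegral_pi_prod_eq_prod_lintegral _ hf]
  exact Finset.prod_congr rfl fun k _ => (withDensity_apply _ (hs k)).symm

end FiniteProducts

/-! ### Partial sums and increments -/

section Increments

/-- The increments `u_1, u_2 - u_1, …` of a finite sequence `u`. -/
def increments {m : ℕ} (u : Fin m → ℝ) (k : Fin m) : ℝ :=
  u k - (Fin.cons 0 u : Fin (m + 1) → ℝ) k.castSucc

/-- The partial sums `w_1, w_1 + w_2, …` of a finite sequence `w`. -/
def partialSums {m : ℕ} (w : Fin m → ℝ) (k : Fin m) : ℝ := ∑ j ∈ Finset.Iic k, w j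

theorem cons_partialSums {m : ℕ} (w : Fin m → ℝ) (k : Fin (m + 1)) :
    (Fin.cons 0 (partialSums w) : Fin (m + 1) → ℝ) k =
      ∑ j : Fin m, if j.castSucc < k then w j else 0 := by
  refine Fin.cases ?_ (fun k => ?_) k
  · simp
  · rw [Fin.cons_succ, partialSums, ← Finset.sum_filter]
    congr 1
    ext j
    simp [Fin.castSucc_lt_succ_iff]

theorem increments_partialSums {m : ℕ} (w : Fin m → ℝ) : increments (partialSums w) = w := by
  funext k
  rw [increments, cons_partialSums]
  have : partialSums w k = ∑ j : Fin m, if j.castSucc < k.succ then w j else 0 := by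
    rw [← cons_partialSums, Fin.cons_succ]
  rw [this, ← Finset.sum_sub_distrib, Finset.sum_eq_single k]
  · simp
  · intro j _ hj
    have : j.castSucc < k.succ ↔ j.castSucc < k.castSucc := by
      rw [Fin.castSucc_lt_succ_iff, Fin.castSucc_lt_castSucc_iff, le_iff_lt_or_eq]
      simp [hj]
    simp [this]
  · simp

/-- Passing from increments to partial sums is given by a triangular matrix with unit diagonal,
hence preserves Lebesgue measure. -/
theorem measurePreserving_partialSums (m : ℕ) :
    MeasurePreserving (partialSums : (Fin m → ℝ) → Fin m → ℝ) := by
  let A : Matrix (Fin m) (Fin m) ℝ := Matrix.of fun k j => if j ≤ k then 1 else 0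
  have hA : (partialSums : (Fin m → ℝ) → Fin m → ℝ) = Matrix.toLin' A := by
    funext w k
    simp only [partialSums, A, Matrix.toLin'_apply, Matrix.mulVec, dotProduct, Matrix.of_apply,
      ite_mul, one_mul, zero_mul]
    rw [← Finset.sum_filter]
    congr 1
    ext j
    simp
  have hdet : A.det = 1 := by
    rw [Matrix.det_of_isLowerTriangular]
    · simp [A]
    · intro i j hij
      simp only [A, Matrix.of_apply]
      rw [if_neg]
      exact not_le.mpr hij
  refine ⟨by unfold partialSums; fun_prop, ?_⟩
  rw [hA, Real.map_matrix_volume_pi_eq_smul_volume_pi (by simp [hdet]), hdet]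
  simp

theorem increments_pos_iff {m : ℕ} (u : Fin m → ℝ) :
    (∀ k, 0 < increments u k) ↔ (∀ k, 0 < u k) ∧ StrictMono u := by
  constructor
  · intro h
    have hmono : StrictMono (Fin.cons 0 u : Fin (m + 1) → ℝ) := by
      rw [Fin.strictMono_iff_lt_succ]
      intro k
      simpa [increments] using h k
    refine ⟨fun k => ?_, fun j k hjk => ?_⟩
    · simpa using hmono (Fin.succ_pos k)
    · simpa using hmono (Fin.succ_lt_succ_iff.mpr hjk)
  · rintro ⟨h0, h⟩ k
    rw [increments, sub_pos]
    obtain ⟨k, hk⟩ := k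
    cases k with
    | zero => simpa using h0 ⟨0, hk⟩
    | succ k =>
      have : (Fin.castSucc ⟨k + 1, hk⟩ : Fin (m + 1)) = Fin.succ ⟨k, by omega⟩ := rfl
      rw [this, Fin.cons_succ]
      exact h (by simp [Fin.lt_def])

theorem measurable_increments {m : ℕ} : Measurable (increments : (Fin m → ℝ) → Fin m → ℝ) := by
  refine measurable_pi_lambda _ fun k => (measurable_pi_apply k).sub ?_
  refine Fin.cases ?_ (fun j => ?_) k.castSucc
  · simp
  · simpa using measurable_pi_apply j

end Increments

/-! ### Exponential holding times -/

section HoldingTimes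

/-- The density on `(0, ∞)` of the exponential law of rate `r` (zero if `r = 0`). -/
noncomputable def expDensity (r x : ℝ) : ℝ≥0∞ :=
  (Set.Ioi 0).indicator (fun x => ENNReal.ofReal (r * Real.exp (-(r * x)))) x

/-- The law on `[0, ∞]` of an exponential variable of rate `r ≥ 0`, which is infinite if `r = 0`. -/
noncomputable def holdingLaw (r : ℝ) : Measure ℝ≥0∞ :=
  (volume.withDensity (expDensity r)).map ENNReal.ofReal + if r = 0 then Measure.dirac ∞ else 0

theorem measurable_expDensity (r : ℝ) : Measurable (expDensity r) :=
  Measurable.indicator (by fun_prop) measurableSet_Ioi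

theorem setLIntegral_expDensity_Ioi {r : ℝ} (hr : 0 < r) {x : ℝ} (hx : 0 ≤ x) :
    ∫⁻ y in Set.Ioi x, expDensity r y = ENNReal.ofReal (Real.exp (-(r * x))) := by
  have h1 : ∫⁻ y in Set.Ioi x, expDensity r y =
      ∫⁻ y in Set.Ioi x, ENNReal.ofReal (r * Real.exp (-r * y)) := by
    refine setLIntegral_congr_fun measurableSet_Ioi fun y hy => ?_
    simp only [expDensity]
    rw [Set.indicator_of_mem (show y ∈ Set.Ioi 0 from hx.trans_lt hy), neg_mul]
  have hint : IntegrableOn (fun y => r * Real.exp (-r * y)) (Set.Ioi x) :=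
    (integrableOn_exp_mul_Ioi (by linarith) x).const_mul r
  rw [h1, ← ofReal_integral_eq_lintegral_ofReal hint
    (Filter.Eventually.of_forall fun y => by positivity), integral_const_mul,
    integral_exp_mul_Ioi (by linarith)]
  congr 1
  field_simp

theorem volume_withDensity_expDensity_univ_le (r : ℝ) :
    volume.withDensity (expDensity r) Set.univ ≤ 1 := by
  rw [withDensity_apply _ MeasurableSet.univ, Measure.restrict_univ]
  rcases le_or_gt r 0 with hr | hr
  · have : expDensity r = 0 := by
      funext x
      simp only [expDensity, Pi.zero_apply]
      refine Set.indicator_apply_eq_zero.mpr fun _ => ENNReal.ofReal_of_nonpos ?_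
      exact mul_nonpos_of_nonpos_of_nonneg hr (Real.exp_nonneg _)
    simp [this]
  · have h := setLIntegral_expDensity_Ioi hr le_rfl
    rw [← lintegral_indicator measurableSet_Ioi] at h
    have h2 : (Set.Ioi (0 : ℝ)).indicator (expDensity r) = expDensity r := by
      funext x
      change (Set.Ioi (0 : ℝ)).indicator ((Set.Ioi 0).indicator _) x = _
      rw [Set.indicator_indicator, Set.inter_self]
      rfl
    rw [h2] at h
    simp [h]

instance (r : ℝ) : IsFiniteMeasure (volume.withDensity (expDensity r)) :=
  ⟨(volume_withDensity_expDensity_univ_le r).trans_lt ENNReal.one_lt_top⟩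

instance (r : ℝ) : IsFiniteMeasure (holdingLaw r) := by
  unfold holdingLaw
  split_ifs <;> infer_instance

theorem holdingLaw_Ioi {r : ℝ} (hr : 0 ≤ r) (x : ℝ≥0) :
    holdingLaw r (Set.Ioi x) = ENNReal.ofReal (Real.exp (-(r * x))) := by
  have hpre : ENNReal.ofReal ⁻¹' Set.Ioi (x : ℝ≥0∞) = Set.Ioi (x : ℝ) := by
    ext y
    simp [ENNReal.lt_ofReal_iff_toReal_lt]
  rw [holdingLaw, Measure.add_apply, Measure.map_apply ENNReal.measurable_ofReal measurableSet_Ioi,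
    hpre, withDensity_apply _ measurableSet_Ioi]
  rcases hr.eq_or_lt with rfl | hr
  · simp [expDensity]
  · rw [setLIntegral_expDensity_Ioi hr x.coe_nonneg]
    simp [hr.ne']

theorem holdingLaw_zero {r : ℝ} : holdingLaw r {0} = 0 := by
  have hpre : ENNReal.ofReal ⁻¹' {(0 : ℝ≥0∞)} = Set.Iic (0 : ℝ) := by
    ext y
    simp
  rw [holdingLaw, Measure.add_apply,
    Measure.map_apply ENNReal.measurable_ofReal (measurableSet_singleton _), hpre,
    withDensity_apply _ measurableSet_Iic, setLIntegral_congr_fun (g := 0) measurableSet_Iic]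
  · split_ifs <;> simp
  · intro y hy
    simpa [expDensity] using fun h : 0 < y => absurd h (not_lt.mpr hy)

theorem isProbabilityMeasure_holdingLaw {r : ℝ} (hr : 0 ≤ r) :
    IsProbabilityMeasure (holdingLaw r) := by
  constructor
  have h := holdingLaw_Ioi hr 0
  have h2 : (Set.univ : Set ℝ≥0∞) = {0} ∪ Set.Ioi 0 := by
    ext x; simp
  rw [h2, measure_union (by simp) measurableSet_Ioi, holdingLaw_zero]
  simpa using h

/-- On finite holding times the exponential law has the density `expDensity`, also for `r = 0`,
where both sides vanish. -/
theorem holdingLaw_restrict (r : ℝ) :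
    (holdingLaw r).restrict {∞}ᶜ = (volume.withDensity (expDensity r)).map ENNReal.ofReal := by
  rw [holdingLaw, Measure.restrict_add]
  have h1 : ((if r = 0 then Measure.dirac ∞ else 0 : Measure ℝ≥0∞)).restrict {∞}ᶜ = 0 := by
    split_ifs
    · simp [Measure.restrict_eq_zero]
    · simp
  rw [h1, add_zero, Measure.restrict_map ENNReal.measurable_ofReal (by measurability)]
  congr 1
  refine Measure.restrict_eq_self_of_ae_mem ?_
  exact Filter.Eventually.of_forall fun x => by simp

/-- A function of independent exponential holding times that vanishes when one of them is infinite
is integrated against the product of the exponential densities. -/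
theorem lintegral_pi_holdingLaw {m : ℕ} (r : Fin m → ℝ) {F : (Fin m → ℝ≥0∞) → ℝ≥0∞}
    (hF : Measurable F) (h0 : ∀ w, (∃ k, w k = ∞) → F w = 0) :
    ∫⁻ w, F w ∂Measure.pi (fun k => holdingLaw (r k)) =
      ∫⁻ w : Fin m → ℝ, (∏ k, expDensity (r k) (w k)) * F fun k => ENNReal.ofReal (w k) := by
  have hs : MeasurableSet (Set.univ.pi fun _ : Fin m => ({∞}ᶜ : Set ℝ≥0∞)) :=
    MeasurableSet.univ_pi fun _ => (measurableSet_singleton _).compl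
  have h1 : F = (Set.univ.pi fun _ : Fin m => ({∞}ᶜ : Set ℝ≥0∞)).indicator F := by
    funext w
    by_cases hw : ∃ k, w k = ∞
    · rw [h0 w hw, eq_comm, Set.indicator_apply_eq_zero]
      exact fun _ => h0 w hw
    · rw [Set.indicator_of_mem]
      simpa using hw
  rw [h1, lintegral_indicator hs, Measure.restrict_pi_pi, ← h1]
  simp_rw [holdingLaw_restrict]
  rw [← Measure.pi_map_pi (fun k => ENNReal.measurable_ofReal.aemeasurable), lintegral_map hF
    (by fun_prop), pi_withDensity _ (fun k => measurable_expDensity (r k)),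
    lintegral_withDensity_eq_lintegral_mul _ ?_ (by fun_prop)]
  · rfl
  · exact Finset.measurable_fun_prod _ fun k _ =>
      (measurable_expDensity (r k)).comp (measurable_pi_apply k)

end HoldingTimes

/-! ### Paths built from a jump chain and holding times -/

section ChainPaths

variable {M : ℕ}

/-- The `p`-th jump time of a path with holding times `w 0, w 1, …`: this is `jumpTime` along a
single trajectory. -/
noncomputable def arrival (w : ℕ → ℝ≥0∞) (p : ℕ) : ℝ≥0∞ := ∑ k ∈ Finset.range p, w k

/-- The number of jumps up to time `τ` of a path with holding times `w` (and `0` if there are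
infinitely many). -/
noncomputable def jumpCount (w : ℕ → ℝ≥0∞) (τ : ℝ≥0∞) : ℕ := {p : ℕ | arrival w (p + 1) ≤ τ}.ncard

/-- The path up to time `τ` of a chain with jump chain `y` and holding times `w`. -/
noncomputable def pathUpTo (y : ℕ → Fin M) (w : ℕ → ℝ≥0∞) (τ : ℝ≥0∞) : HiddenPath M :=
  ⟨jumpCount w τ, fun p => y p, fun p => (arrival w (p + 1)).toReal⟩

/-- The holding times `w` let only finitely many jumps occur in finite time. -/
def NonExplosive (w : ℕ → ℝ≥0∞) : Prop := ∀ x : ℝ≥0, ∃ p, (x : ℝ≥0∞) < arrival w p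

theorem arrival_mono (w : ℕ → ℝ≥0∞) : Monotone (arrival w) := fun _ _ h =>
  Finset.sum_le_sum_of_subset (Finset.range_mono h)

theorem jumpCount_eq {w : ℕ → ℝ≥0∞} {τ : ℝ≥0∞} {n : ℕ} (h₁ : arrival w n ≤ τ)
    (h₂ : τ < arrival w (n + 1)) : jumpCount w τ = n := by
  have : {p : ℕ | arrival w (p + 1) ≤ τ} = ((Finset.range n : Finset ℕ) : Set ℕ) := by
    ext p
    simp only [Set.mem_ofPred_eq, Finset.coe_range, Set.mem_Iio]
    constructor
    · intro h
      by_contra hp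
      exact absurd (h₂.trans_le (arrival_mono w (by omega : n + 1 ≤ p + 1))) (not_lt.mpr h)
    · intro h
      exact (arrival_mono w (by omega : p + 1 ≤ n)).trans h₁
  rw [jumpCount, this, Set.ncard_coe_finset, Finset.card_range]

theorem exists_arrival_le_lt {w : ℕ → ℝ≥0∞} {τ : ℝ≥0∞} (h : ∃ p, τ < arrival w p) :
    ∃ n, arrival w n ≤ τ ∧ τ < arrival w (n + 1) := by
  classical
  have hpos : Nat.find h ≠ 0 := fun h0 => by
    have := Nat.find_spec h
    rw [h0] at this
    simp [arrival] at this
  obtain ⟨n, hn⟩ := Nat.exists_eq_succ_of_ne_zero hpos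
  refine ⟨n, not_lt.mp (Nat.find_min h (by omega)), ?_⟩
  have := Nat.find_spec h
  rwa [hn] at this

theorem NonExplosive.jumpCount_spec {w : ℕ → ℝ≥0∞} (hw : NonExplosive w) {τ : ℝ≥0∞}
    (hτ : τ ≠ ∞) : arrival w (jumpCount w τ) ≤ τ ∧ τ < arrival w (jumpCount w τ + 1) := by
  lift τ to ℝ≥0 using hτ
  obtain ⟨n, h₁, h₂⟩ := exists_arrival_le_lt (hw τ)
  rw [jumpCount_eq h₁ h₂]
  exact ⟨h₁, h₂⟩

/-- The second alternative is the junk value of `Set.ncard`: an explosive path makes infinitely many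
jumps, which count as `0`. -/
theorem jumpCount_eq_iff {w : ℕ → ℝ≥0∞} {τ : ℝ≥0∞} {n : ℕ} :
    jumpCount w τ = n ↔ (arrival w n ≤ τ ∧ τ < arrival w (n + 1)) ∨
      (n = 0 ∧ ∀ p, arrival w p ≤ τ) := by
  by_cases h : ∃ p, τ < arrival w p
  · obtain ⟨k, h₁, h₂⟩ := exists_arrival_le_lt h
    rw [jumpCount_eq h₁ h₂]
    constructor
    · rintro rfl
      exact Or.inl ⟨h₁, h₂⟩
    · rintro (⟨h₃, h₄⟩ | ⟨-, h₃⟩)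
      · rw [← jumpCount_eq h₁ h₂, jumpCount_eq h₃ h₄]
      · exact absurd h₂ (not_lt.mpr (h₃ _))
  · push Not at h
    have : jumpCount w τ = 0 := by
      have : {p : ℕ | arrival w (p + 1) ≤ τ} = Set.univ := Set.eq_univ_of_forall fun p => h _
      rw [jumpCount, this, Set.ncard_univ, Nat.card_eq_zero_of_infinite]
    rw [this]
    constructor
    · rintro rfl
      exact Or.inr ⟨rfl, h⟩
    · rintro (⟨-, h₃⟩ | ⟨h₃, -⟩)
      · exact absurd h₃ (not_lt.mpr (h _))
      · exact h₃.symm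

theorem measurable_arrival (p : ℕ) : Measurable fun w : ℕ → ℝ≥0∞ => arrival w p := by
  unfold arrival
  fun_prop

theorem measurable_jumpCount :
    Measurable fun z : (ℕ → ℝ≥0∞) × ℝ≥0∞ => jumpCount z.1 z.2 := by
  have harr : ∀ p, Measurable fun z : (ℕ → ℝ≥0∞) × ℝ≥0∞ => arrival z.1 p := fun p =>
    (measurable_arrival p).comp measurable_fst
  refine measurable_to_countable' fun n => ?_
  have : (fun z : (ℕ → ℝ≥0∞) × ℝ≥0∞ => jumpCount z.1 z.2) ⁻¹' {n} =
      ({z | arrival z.1 n ≤ z.2} ∩ {z | z.2 < arrival z.1 (n + 1)}) ∪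
        ({_z | n = 0} ∩ ⋂ p, {z | arrival z.1 p ≤ z.2}) := by
    ext z
    simp [jumpCount_eq_iff]
  rw [this]
  exact ((measurableSet_le (harr _) measurable_snd).inter
    (measurableSet_lt measurable_snd (harr _))).union ((MeasurableSet.const _).inter
      (MeasurableSet.iInter fun p => measurableSet_le (harr _) measurable_snd))

/-- A map into a countable disjoint union that follows `g n` where the index is `n`. -/
theorem measurable_sigma_mk {α : Type*} [MeasurableSpace α] {β : ℕ → Type*}
    [∀ n, MeasurableSpace (β n)] {N : α → ℕ} {g : ∀ n, α → β n} (hN : Measurable N)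
    (hg : ∀ n, Measurable (g n)) : Measurable fun a => (⟨N a, g (N a) a⟩ : Σ n, β n) := by
  intro B hB
  have : (fun a => (⟨N a, g (N a) a⟩ : Σ n, β n)) ⁻¹' B =
      ⋃ n, N ⁻¹' {n} ∩ g n ⁻¹' (Sigma.mk n ⁻¹' B) := by
    ext a
    simp
  rw [this]
  refine MeasurableSet.iUnion fun n => (hN (measurableSet_singleton n)).inter (hg n ?_)
  exact MeasurableSpace.measurableSet_iInf.mp hB n

theorem measurable_sigmaMk {β : ℕ → Type*} [∀ n, MeasurableSpace (β n)] (n : ℕ) :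
    Measurable (Sigma.mk n : β n → Σ n, β n) := fun _ hB =>
  MeasurableSpace.measurableSet_iInf.mp hB n

theorem measurable_sigma_iff {α : Type*} [MeasurableSpace α] {β : ℕ → Type*}
    [∀ n, MeasurableSpace (β n)] {f : (Σ n, β n) → α} :
    Measurable f ↔ ∀ n, Measurable fun x : β n => f ⟨n, x⟩ :=
  ⟨fun h n => h.comp (measurable_sigmaMk n), fun h _ hB =>
    MeasurableSpace.measurableSet_iInf.mpr fun n => h n hB⟩

theorem measurable_pathUpTo :
    Measurable fun z : ((ℕ → Fin M) × (ℕ → ℝ≥0∞)) × ℝ≥0∞ => pathUpTo z.1.1 z.1.2 z.2 := by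
  have hN : Measurable fun z : ((ℕ → Fin M) × (ℕ → ℝ≥0∞)) × ℝ≥0∞ => jumpCount z.1.2 z.2 :=
    measurable_jumpCount.comp (f := fun z : ((ℕ → Fin M) × (ℕ → ℝ≥0∞)) × ℝ≥0∞ => (z.1.2, z.2))
      (by fun_prop)
  refine measurable_sigma_mk (β := fun m => (Fin (m + 1) → Fin M) × (Fin m → ℝ))
    (g := fun n z => (fun p : Fin (n + 1) => z.1.1 p,
      fun p : Fin n => (arrival z.1.2 (p + 1)).toReal)) hN fun n => ?_
  refine Measurable.prodMk (by fun_prop) (measurable_pi_lambda _ fun p => ?_)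
  exact ((measurable_arrival _).comp (measurable_snd.comp measurable_fst)).ennreal_toReal

end ChainPaths

/-! ### The first jump times -/

section FiniteArrival

/-- The `p`-th jump time, for `p ≤ n`, of a path with first holding times `w 0, …, w (n - 1)`.
Unlike `arrival` it can be integrated against a finite product of exponential laws. -/
noncomputable def finArrival {n : ℕ} (w : Fin n → ℝ≥0∞) (p : ℕ) : ℝ≥0∞ :=
  ∑ j : Fin n, if (j : ℕ) < p then w j else 0

theorem measurable_finArrival {n : ℕ} (p : ℕ) :
    Measurable fun w : Fin n → ℝ≥0∞ => finArrival w p := by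
  unfold finArrival
  refine Finset.measurable_fun_sum _ fun j _ => ?_
  split_ifs <;> fun_prop

theorem finArrival_eq_arrival {n p : ℕ} (hp : p ≤ n) (w : ℕ → ℝ≥0∞) :
    finArrival (fun k : Fin n => w k) p = arrival w p := by
  rw [finArrival, ← Finset.sum_range (fun j => if j < p then w j else 0), ← Finset.sum_filter,
    arrival]
  congr 1
  ext j
  simp
  omega

theorem finArrival_snoc_of_le {n p : ℕ} (hp : p ≤ n) (w : Fin n → ℝ≥0∞) (y : ℝ≥0∞) :
    finArrival (Fin.snoc w y : Fin (n + 1) → ℝ≥0∞) p = finArrival w p := by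
  simp [finArrival, Fin.sum_univ_castSucc, not_lt.mpr hp]

theorem finArrival_snoc_succ {n : ℕ} (w : Fin n → ℝ≥0∞) (y : ℝ≥0∞) :
    finArrival (Fin.snoc w y : Fin (n + 1) → ℝ≥0∞) (n + 1) = finArrival w n + y := by
  simp [finArrival, Fin.sum_univ_castSucc]

theorem finArrival_eq_top {n : ℕ} {w : Fin n → ℝ≥0∞} (h : ∃ k, w k = ∞) :
    finArrival w n = ∞ := by
  obtain ⟨k, hk⟩ := h
  rw [finArrival, ENNReal.sum_eq_top]
  exact ⟨k, Finset.mem_univ _, by simp [hk]⟩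

theorem finArrival_ofReal {n : ℕ} {w : Fin n → ℝ} (hw : ∀ k, 0 ≤ w k) (p : Fin (n + 1)) :
    finArrival (fun k => ENNReal.ofReal (w k)) p =
      ENNReal.ofReal ((Fin.cons 0 (partialSums w) : Fin (n + 1) → ℝ) p) := by
  rw [cons_partialSums, ENNReal.ofReal_sum_of_nonneg]
  · refine Finset.sum_congr rfl fun j _ => ?_
    by_cases h : (j : ℕ) < p
    · rw [if_pos h, if_pos (by simpa [Fin.lt_def] using h)]
    · rw [if_neg h, if_neg (by simpa [Fin.lt_def] using h), ENNReal.ofReal_zero]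
  · intro j _
    split_ifs
    exacts [hw j, le_rfl]

theorem cons_partialSums_nonneg {n : ℕ} {w : Fin n → ℝ} (hw : ∀ k, 0 ≤ w k) (p : Fin (n + 1)) :
    0 ≤ (Fin.cons 0 (partialSums w) : Fin (n + 1) → ℝ) p := by
  rw [cons_partialSums]
  refine Finset.sum_nonneg fun j _ => ?_
  split_ifs
  exacts [hw j, le_rfl]

/-- A state entered at time `a` is still occupied at time `τ` with probability `e^{-r (τ - a)}`. -/
theorem holdingLaw_exceeds {r : ℝ} (hr : 0 ≤ r) {τ : ℝ} (hτ : 0 ≤ τ) {a : ℝ≥0∞}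
    (ha : a ≤ ENNReal.ofReal τ) :
    holdingLaw r {y | ENNReal.ofReal τ < a + y} =
      ENNReal.ofReal (Real.exp (-(r * (τ - a.toReal)))) := by
  have hfin : a ≠ ∞ := ne_top_of_le_ne_top ENNReal.ofReal_ne_top ha
  have hset : {y | ENNReal.ofReal τ < a + y} = Set.Ioi (ENNReal.ofReal τ - a) := by
    ext y
    exact (ENNReal.sub_lt_iff_lt_left hfin ha).symm
  have hsub : ENNReal.ofReal τ - a = ((τ - a.toReal).toNNReal : ℝ≥0) := by
    rw [← ENNReal.ofReal_toReal hfin, ← ENNReal.ofReal_sub _ ENNReal.toReal_nonneg,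
      ENNReal.toReal_ofReal ENNReal.toReal_nonneg]
    rfl
  rw [hset, hsub, holdingLaw_Ioi hr,
    Real.coe_toNNReal _ (sub_nonneg.mpr (ENNReal.toReal_le_of_le_ofReal hτ ha))]

theorem measurable_cons_apply {m : ℕ} (p : Fin (m + 1)) :
    Measurable fun u : Fin m → ℝ => (Fin.cons 0 u : Fin (m + 1) → ℝ) p := by
  refine Fin.cases ?_ (fun k => ?_) p
  · simp
  · simp only [Fin.cons_succ]
    fun_prop

/-- The law of the first `m` jump times on the event that there are exactly `m` jumps up to time
`τ`, for independent exponential holding times of rates `r`. -/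
theorem lintegral_pi_holdingLaw_jumps {m : ℕ} {r : Fin (m + 1) → ℝ} (hr : ∀ k, 0 ≤ r k) {τ : ℝ}
    (hτ : 0 ≤ τ) {G : (Fin m → ℝ) → ℝ≥0∞} (hG : Measurable G) :
    ∫⁻ w, (if finArrival w m ≤ ENNReal.ofReal τ ∧ ENNReal.ofReal τ < finArrival w (m + 1) then
        G (fun p : Fin m => (finArrival w (p + 1)).toReal) else 0)
        ∂Measure.pi (fun k => holdingLaw (r k)) =
      ∫⁻ u : Fin m → ℝ, (∏ k : Fin m, expDensity (r k.castSucc) (increments u k)) *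
        if (Fin.cons 0 u : Fin (m + 1) → ℝ) (Fin.last m) ≤ τ then
          ENNReal.ofReal (Real.exp (-(r (Fin.last m) *
            (τ - (Fin.cons 0 u : Fin (m + 1) → ℝ) (Fin.last m))))) * G u else 0 := by
  have hmeas : ∀ {n : ℕ}, Measurable fun w : Fin n → ℝ≥0∞ =>
      G (fun p : Fin m => (finArrival w (p + 1)).toReal) := fun {n} =>
    hG.comp (measurable_pi_lambda _ fun p => (measurable_finArrival _).ennreal_toReal)
  rw [lintegral_pi_snoc]
  swap
  · exact Measurable.ite ((measurableSet_le (measurable_finArrival _) measurable_const).inter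
      (measurableSet_lt measurable_const (measurable_finArrival _))) hmeas measurable_const
  have hinner : ∀ w : Fin m → ℝ≥0∞, ∫⁻ y, (if finArrival (Fin.snoc w y : Fin (m + 1) → ℝ≥0∞) m ≤
        ENNReal.ofReal τ ∧
        ENNReal.ofReal τ < finArrival (Fin.snoc w y : Fin (m + 1) → ℝ≥0∞) (m + 1) then
        G (fun p : Fin m => (finArrival (Fin.snoc w y : Fin (m + 1) → ℝ≥0∞) (p + 1)).toReal) else 0)
        ∂holdingLaw (r (Fin.last m)) =
      if finArrival w m ≤ ENNReal.ofReal τ then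
        ENNReal.ofReal (Real.exp (-(r (Fin.last m) * (τ - (finArrival w m).toReal)))) *
          G (fun p : Fin m => (finArrival w (p + 1)).toReal) else 0 := by
    intro w
    have hp : ∀ (p : Fin m) y, finArrival (Fin.snoc w y : Fin (m + 1) → ℝ≥0∞) (p + 1) =
        finArrival w (p + 1) := fun p y => finArrival_snoc_of_le p.2 w y
    simp_rw [hp, finArrival_snoc_of_le le_rfl, finArrival_snoc_succ]
    split_ifs with h
    · simp_rw [h, true_and]
      rw [← holdingLaw_exceeds (hr _) hτ h, mul_comm, ← lintegral_indicator_const]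
      · refine lintegral_congr fun y => ?_
        rw [Set.indicator_apply]
        rfl
      · exact measurableSet_lt measurable_const (measurable_const.add measurable_id)
    · simp [h]
  simp_rw [hinner]
  rw [lintegral_pi_holdingLaw (fun k : Fin m => r k.castSucc)]
  · refine Eq.trans ?_ ((measurePreserving_partialSums m).lintegral_comp ?_)
    · refine lintegral_congr fun w => ?_
      rw [increments_partialSums]
      by_cases hw : ∀ k, 0 < w k
      · congr 1
        have h0 : ∀ k, 0 ≤ w k := fun k => (hw k).le
        have h1 : finArrival (fun k => ENNReal.ofReal (w k)) m =
            ENNReal.ofReal ((Fin.cons 0 (partialSums w) : Fin (m + 1) → ℝ) (Fin.last m)) :=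
          finArrival_ofReal h0 (Fin.last m)
        have h2 : (fun p : Fin m =>
            (finArrival (fun k => ENNReal.ofReal (w k)) (p + 1)).toReal) = partialSums w := by
          funext p
          have := finArrival_ofReal h0 p.succ
          have h3 := cons_partialSums_nonneg h0 p.succ
          rw [Fin.cons_succ] at this h3
          rw [← Fin.val_succ, this, ENNReal.toReal_ofReal h3]
        rw [h1, h2, ENNReal.toReal_ofReal (cons_partialSums_nonneg h0 _)]
        simp only [ENNReal.ofReal_le_ofReal_iff hτ]
      · push Not at hw
        obtain ⟨k, hk⟩ := hw
        have : ∏ k : Fin m, expDensity (r k.castSucc) (w k) = 0 := by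
          refine Finset.prod_eq_zero (Finset.mem_univ k) ?_
          exact Set.indicator_of_notMem (by simpa using hk) _
        simp [this]
    · refine Measurable.mul (Finset.measurable_fun_prod _ fun k _ =>
        (measurable_expDensity _).comp ((measurable_pi_apply k).comp measurable_increments)) ?_
      have := measurable_cons_apply (Fin.last m)
      exact Measurable.ite (measurableSet_le this measurable_const) (by fun_prop) measurable_const
  · have := measurable_finArrival (n := m) m
    exact Measurable.ite (measurableSet_le this measurable_const)
      (Measurable.mul (by fun_prop) hmeas) measurable_const
  · intro w hw
    rw [if_neg]
    simp [finArrival_eq_top hw]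

end FiniteArrival

/-! ### The jump chain and its holding times -/

section ChainLaw

variable {M : ℕ}

theorem Params.q_eq_sum (θ : Params M) (i : Fin M) :
    θ.q i = ∑ j ∈ Finset.univ.erase i, θ.Q i j := by
  have h := θ.Q_row_sum i
  rw [← Finset.add_sum_erase _ _ (Finset.mem_univ i)] at h
  rw [Params.q]
  linarith

theorem Params.q_nonneg (θ : Params M) (i : Fin M) : 0 ≤ θ.q i := by
  rw [θ.q_eq_sum]
  exact Finset.sum_nonneg fun j hj => θ.Q_nonneg i j (Finset.ne_of_mem_erase hj).symm

theorem Params.Q_le_q (θ : Params M) {i j : Fin M} (hij : i ≠ j) : θ.Q i j ≤ θ.q i := by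
  rw [θ.q_eq_sum]
  exact Finset.single_le_sum (f := fun j => θ.Q i j)
    (fun j hj => θ.Q_nonneg i j (Finset.ne_of_mem_erase hj).symm)
    (Finset.mem_erase.mpr ⟨hij.symm, Finset.mem_univ j⟩)

theorem Params.jumpMatrix_nonneg (θ : Params M) (i j : Fin M) : 0 ≤ θ.jumpMatrix i j := by
  unfold Params.jumpMatrix
  split_ifs with h
  · exact zero_le_one
  · exact le_rfl
  · exact div_nonneg (θ.Q_nonneg i j h) (θ.q_nonneg i)

/-- If `q i = 0` then `jumpMatrix i j` is the junk value `Q i j / 0`, but `Q i j` vanishes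
as well. -/
theorem Params.jumpMatrix_mul_q (θ : Params M) (i j : Fin M) :
    θ.jumpMatrix i j * θ.q i = if i = j then 0 else θ.Q i j := by
  unfold Params.jumpMatrix
  by_cases h : i = j
  · simp [h]
  · rw [if_neg h, if_neg h]
    by_cases h0 : θ.q i = 0
    · rw [h0, mul_zero]
      exact le_antisymm (θ.Q_nonneg i j h) (h0 ▸ θ.Q_le_q h)
    · field_simp

theorem Params.jumpMatrix_row_sum (θ : Params M) (i : Fin M) : ∑ j, θ.jumpMatrix i j = 1 := by
  rw [← Finset.add_sum_erase _ _ (Finset.mem_univ i)]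
  have h : ∀ j ∈ Finset.univ.erase i, θ.jumpMatrix i j = θ.Q i j / θ.q i := fun j hj => by
    rw [Params.jumpMatrix, if_neg (Finset.ne_of_mem_erase hj).symm]
  rw [Finset.sum_congr rfl h, ← Finset.sum_div, ← θ.q_eq_sum]
  by_cases h0 : θ.q i = 0 <;> simp [Params.jumpMatrix, h0]

/-- The probability that the jump chain starts with the states `i`. -/
noncomputable def Params.jumpWeight (θ : Params M) {p : ℕ} (i : Fin (p + 1) → Fin M) : ℝ :=
  θ.ξ (i 0) * ∏ k : Fin p, θ.jumpMatrix (i k.castSucc) (i k.succ)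

theorem Params.jumpWeight_nonneg (θ : Params M) {p : ℕ} (i : Fin (p + 1) → Fin M) :
    0 ≤ θ.jumpWeight i :=
  mul_nonneg (θ.ξ_nonneg _) (Finset.prod_nonneg fun _ _ => θ.jumpMatrix_nonneg _ _)

theorem Params.sum_jumpWeight (θ : Params M) (p : ℕ) :
    ∑ i : Fin (p + 1) → Fin M, θ.jumpWeight i = 1 := by
  induction p with
  | zero =>
    rw [← (Equiv.funUnique (Fin 1) (Fin M)).symm.sum_comp]
    simpa [Params.jumpWeight] using θ.ξ_sum
  | succ p ih =>
    rw [← (Fin.snocEquiv fun _ => Fin M).sum_comp, Fintype.sum_prod_type_right, ← ih]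
    refine Finset.sum_congr rfl fun i _ => ?_
    have : ∀ j, θ.jumpWeight (Fin.snoc i j : Fin (p + 2) → Fin M) =
        θ.jumpWeight i * θ.jumpMatrix (i (Fin.last p)) j := by
      intro j
      have h0 : (Fin.snoc i j : Fin (p + 2) → Fin M) 0 = i 0 :=
        Fin.snoc_castSucc (α := fun _ => Fin M) j i 0
      simp only [Params.jumpWeight, Fin.prod_univ_castSucc, h0, mul_assoc]
      congr 2
      · refine Finset.prod_congr rfl fun k _ => ?_
        rw [Fin.snoc_castSucc (α := fun _ => Fin M), ← Fin.castSucc_succ,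
          Fin.snoc_castSucc (α := fun _ => Fin M)]
      · rw [Fin.snoc_castSucc (α := fun _ => Fin M), Fin.succ_last,
          Fin.snoc_last (α := fun _ => Fin M)]
    refine (Finset.sum_congr rfl fun j _ => this j).trans ?_
    rw [← Finset.mul_sum, θ.jumpMatrix_row_sum, mul_one]

variable {Ω : Type*} [MeasurableSpace Ω] {θ : Params M} {P : Measure Ω} {S : ℝ → Ω → Fin M}
  {Y : ℕ → Ω → Fin M} {W : ℕ → Ω → ℝ≥0∞}

theorem measurableSet_states (hc : IsMarkovChain θ P S Y W) {p : ℕ} (i : Fin (p + 1) → Fin M) :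
    MeasurableSet {ω | ∀ k : Fin (p + 1), Y k ω = i k} := by
  have : {ω | ∀ k : Fin (p + 1), Y k ω = i k} = ⋂ k : Fin (p + 1), Y k ⁻¹' {i k} := by
    ext; simp
  rw [this]
  exact MeasurableSet.iInter fun k => hc.measurable_Y k (measurableSet_singleton _)

/-- `IsMarkovChain.law` for `x = 0`, summed over the states visited, gives total mass `1`. -/
theorem IsMarkovChain.ae_pos [IsProbabilityMeasure P] (hc : IsMarkovChain θ P S Y W) :
    ∀ᵐ ω ∂P, ∀ k, 0 < W k ω := by
  rw [ae_all_iff]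
  intro n
  let A : (Fin (n + 1) → Fin M) → Set Ω := fun i =>
    {ω | ∀ k : Fin (n + 1), Y k ω = i k ∧ ((0 : ℝ≥0) : ℝ≥0∞) < W k ω}
  have hA : ∀ i, MeasurableSet (A i) := fun i => by
    have : A i = {ω | ∀ k : Fin (n + 1), Y k ω = i k} ∩
        ⋂ k : Fin (n + 1), W k ⁻¹' Set.Ioi ((0 : ℝ≥0) : ℝ≥0∞) := by
      ext; simp [A, forall_and]
    rw [this]
    exact (measurableSet_states hc i).inter
      (MeasurableSet.iInter fun k => hc.measurable_W k measurableSet_Ioi)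
  have hPA : ∀ i, P (A i) = ENNReal.ofReal (θ.jumpWeight i) := fun i => by
    have := hc.law n i (fun _ => 0)
    simpa [A, Params.jumpWeight] using this
  have hdisj : Pairwise (Function.onFun Disjoint A) := fun i j hij =>
    Set.disjoint_left.mpr fun ω hi hj => hij (funext fun k => (hi k).1.symm.trans (hj k).1)
  have hU : P (⋃ i, A i) = 1 := by
    rw [measure_iUnion hdisj hA, tsum_fintype, Finset.sum_congr rfl fun i _ => hPA i,
      ← ENNReal.ofReal_sum_of_nonneg fun i _ => θ.jumpWeight_nonneg i, θ.sum_jumpWeight,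
      ENNReal.ofReal_one]
  filter_upwards [(mem_ae_iff_prob_eq_one (MeasurableSet.iUnion hA)).mpr hU] with ω hω
  obtain ⟨i, hi⟩ := Set.mem_iUnion.mp hω
  simpa using (hi (Fin.last n)).2

/-- Given the first states of the jump chain, the holding times are independent exponentials. -/
theorem IsMarkovChain.map_holdingTimes [IsProbabilityMeasure P] (hc : IsMarkovChain θ P S Y W)
    {p : ℕ} (i : Fin (p + 1) → Fin M) :
    (P.restrict {ω | ∀ k : Fin (p + 1), Y k ω = i k}).map (fun ω (k : Fin (p + 1)) => W k ω) =
      ENNReal.ofReal (θ.jumpWeight i) • Measure.pi fun k => holdingLaw (θ.q (i k)) := by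
  have hprob : ∀ k, IsProbabilityMeasure (holdingLaw (θ.q (i k))) := fun k =>
    isProbabilityMeasure_holdingLaw (θ.q_nonneg _)
  have hW : Measurable fun ω (k : Fin (p + 1)) => W k ω :=
    measurable_pi_lambda _ fun k => hc.measurable_W k
  have hY := measurableSet_states hc i
  have : IsFiniteMeasure (ENNReal.ofReal (θ.jumpWeight i) •
      Measure.pi fun k => holdingLaw (θ.q (i k))) :=
    Measure.smul_finite _ ENNReal.ofReal_ne_top
  let C : Set (Set ℝ≥0∞) := insert Set.univ (Set.range Set.Ioi)
  have hC : MeasurableSpace.generateFrom C = inferInstanceAs (MeasurableSpace ℝ≥0∞) := by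
    rw [MeasurableSpace.generateFrom_insert_univ, ← borel_eq_generateFrom_Ioi]
    exact (BorelSpace.measurable_eq).symm
  have hspan : IsCountablySpanning C :=
    ⟨fun _ => Set.univ, fun _ => Set.mem_insert _ _, Set.iUnion_const _⟩
  -- Up to null sets a member of the π-system `C` is empty or a half-line `(x, ∞]`.
  have hrect : ∀ s : Fin (p + 1) → Set ℝ≥0∞, (∀ k, s k ∈ C) →
      (P.restrict {ω | ∀ k : Fin (p + 1), Y k ω = i k}).map (fun ω (k : Fin (p + 1)) => W k ω)
        (Set.univ.pi s) = (ENNReal.ofReal (θ.jumpWeight i) •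
          Measure.pi fun k => holdingLaw (θ.q (i k))) (Set.univ.pi s) := by
    intro s hs
    have hsm : ∀ k, MeasurableSet (s k) := fun k => by
      rcases hs k with h | ⟨a, h⟩
      · rw [h]; exact MeasurableSet.univ
      · rw [← h]; exact measurableSet_Ioi
    by_cases hempty : ∃ k, s k = ∅
    · rw [Set.univ_pi_eq_empty_iff.mpr hempty]
      simp
    · push Not at hempty
      have hx : ∀ k, ∃ x : ℝ≥0, ∀ w : ℝ≥0∞, 0 < w → (w ∈ s k ↔ (x : ℝ≥0∞) < w) := by
        intro k
        rcases hs k with h | ⟨a, h⟩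
        · exact ⟨0, fun w hw => by simp [h, hw]⟩
        · have ha : a ≠ ∞ := by
            rintro rfl
            have := hempty k
            rw [← h] at this
            simp at this
          lift a to ℝ≥0 using ha
          exact ⟨a, fun w _ => by simp [← h]⟩
      choose x hx using hx
      have hlhs : P ((fun ω (k : Fin (p + 1)) => W k ω) ⁻¹' Set.univ.pi s ∩
          {ω | ∀ k : Fin (p + 1), Y k ω = i k}) =
          P {ω | ∀ k : Fin (p + 1), Y k ω = i k ∧ (x k : ℝ≥0∞) < W k ω} := by
        refine measure_congr (Filter.eventuallyEq_set.mpr ?_)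
        filter_upwards [hc.ae_pos] with ω hω
        simp only [Set.mem_inter_iff, Set.mem_preimage, Set.mem_univ_pi, Set.mem_ofPred_eq,
          hx _ _ (hω _), forall_and]
        exact and_comm
      have hrhs : ∀ k, holdingLaw (θ.q (i k)) (s k) =
          ENNReal.ofReal (Real.exp (-θ.q (i k) * x k)) := by
        intro k
        rw [neg_mul, ← holdingLaw_Ioi (θ.q_nonneg _)]
        refine measure_congr (Filter.eventuallyEq_set.mpr ?_)
        have h0 : ∀ᵐ w ∂holdingLaw (θ.q (i k)), w ≠ 0 := by
          rw [ae_iff]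
          simpa using holdingLaw_zero
        filter_upwards [h0] with w hw
        exact hx k w (pos_iff_ne_zero.mpr hw)
      rw [Measure.map_apply hW (MeasurableSet.univ_pi hsm), Measure.restrict_apply
        (hW (MeasurableSet.univ_pi hsm)), hlhs, hc.law, Measure.smul_apply, Measure.pi_pi,
        Finset.prod_congr rfl fun k _ => hrhs k, smul_eq_mul,
        ← ENNReal.ofReal_prod_of_nonneg fun k _ => Real.exp_nonneg _,
        ← ENNReal.ofReal_mul (θ.jumpWeight_nonneg i)]
      rfl
  refine ext_of_generate_finite _ (generateFrom_eq_pi (fun _ => hC) fun _ => hspan).symm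
    (IsPiSystem.pi fun _ => isPiSystem_Ioi.insert_univ) ?_ ?_
  · rintro _ ⟨s, hs, rfl⟩
    exact hrect s fun k => hs k (Set.mem_univ k)
  · have := hrect (fun _ => Set.univ) fun k => Set.mem_insert _ _
    rwa [Set.pi_univ] at this

/-- The jumps of the chain do not accumulate: as the exit rates are bounded, infinitely many
holding times exceed `1`. -/
theorem IsMarkovChain.ae_nonExplosive [IsProbabilityMeasure P] (hc : IsMarkovChain θ P S Y W) :
    ∀ᵐ ω ∂P, NonExplosive fun k => W k ω := by
  let R : ℝ := ∑ i, θ.q i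
  have hR : ∀ i, θ.q i ≤ R := fun i =>
    Finset.single_le_sum (fun j _ => θ.q_nonneg j) (Finset.mem_univ i)
  let ρ : ℝ≥0∞ := 1 - ENNReal.ofReal (Real.exp (-R))
  have hρ : ρ < 1 := ENNReal.sub_lt_self ENNReal.one_ne_top one_ne_zero
    (by simpa using Real.exp_pos _)
  have hshort : ∀ i, holdingLaw (θ.q i) (Set.Iic 1) ≤ ρ := by
    intro i
    have := isProbabilityMeasure_holdingLaw (θ.q_nonneg i)
    have h := holdingLaw_Ioi (θ.q_nonneg i) 1
    rw [← Set.compl_Ioi, prob_compl_eq_one_sub measurableSet_Ioi]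
    rw [ENNReal.coe_one] at h
    rw [h]
    refine tsub_le_tsub_left (ENNReal.ofReal_le_ofReal (Real.exp_le_exp.mpr ?_)) _
    simpa using hR i
  -- `p` consecutive holding times are all at most `1` with probability at most `ρ ^ p`.
  have hrun : ∀ n p : ℕ, P {ω | ∀ k ∈ Set.Ico n (n + p), W k ω ≤ 1} ≤ ρ ^ p := by
    intro n p
    let s : Fin (n + p + 1) → Set ℝ≥0∞ := fun k =>
      if (k : ℕ) ∈ Set.Ico n (n + p) then Set.Iic 1 else Set.univ
    have hs : ∀ k, MeasurableSet (s k) := fun k => by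
      simp only [s]
      split_ifs
      exacts [measurableSet_Iic, MeasurableSet.univ]
    have hW : Measurable fun ω (k : Fin (n + p + 1)) => W k ω :=
      measurable_pi_lambda _ fun k => hc.measurable_W k
    have hcover : {ω | ∀ k ∈ Set.Ico n (n + p), W k ω ≤ 1} ⊆
        ⋃ i : Fin (n + p + 1) → Fin M, (fun ω (k : Fin (n + p + 1)) => W k ω) ⁻¹' Set.univ.pi s ∩
          {ω | ∀ k : Fin (n + p + 1), Y k ω = i k} := by
      intro ω hω
      refine Set.mem_iUnion.mpr ⟨fun k => Y k ω, ?_, fun k => rfl⟩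
      simp only [Set.mem_preimage, Set.mem_univ_pi, s]
      intro k
      split_ifs with hk
      · exact hω k hk
      · trivial
    have hprod : ∀ i : Fin (n + p + 1) → Fin M,
        (Measure.pi fun k => holdingLaw (θ.q (i k))) (Set.univ.pi s) ≤ ρ ^ p := by
      intro i
      rw [Measure.pi_pi]
      have h1 : ∀ k, holdingLaw (θ.q (i k)) (s k) ≤
          if (k : ℕ) ∈ Set.Ico n (n + p) then ρ else 1 := by
        intro k
        have := isProbabilityMeasure_holdingLaw (θ.q_nonneg (i k))
        simp only [s]
        split_ifs
        · exact hshort _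
        · exact prob_le_one
      refine (Finset.prod_le_prod' fun k _ => h1 k).trans (le_of_eq ?_)
      rw [Finset.prod_range (fun k => if k ∈ Set.Ico n (n + p) then ρ else 1) |>.symm,
        ← Finset.prod_filter, Finset.prod_const]
      congr 1
      have : (Finset.range (n + p + 1)).filter (fun k => k ∈ Set.Ico n (n + p)) =
          Finset.Ico n (n + p) := by
        ext k; simp; omega
      rw [this]; simp
    calc P {ω | ∀ k ∈ Set.Ico n (n + p), W k ω ≤ 1}
        ≤ ∑ i : Fin (n + p + 1) → Fin M, ENNReal.ofReal (θ.jumpWeight i) * ρ ^ p := by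
          refine (measure_mono hcover).trans ((measure_iUnion_le _).trans ?_)
          rw [tsum_fintype]
          refine Finset.sum_le_sum fun i _ => ?_
          rw [← Measure.restrict_apply (hW (MeasurableSet.univ_pi hs)),
            ← Measure.map_apply hW (MeasurableSet.univ_pi hs), hc.map_holdingTimes,
            Measure.smul_apply, smul_eq_mul]
          gcongr
          exact hprod i
      _ = ρ ^ p := by
          rw [← Finset.sum_mul, ← ENNReal.ofReal_sum_of_nonneg fun i _ => θ.jumpWeight_nonneg i,
            θ.sum_jumpWeight, ENNReal.ofReal_one, one_mul]
  have hlong : ∀ᵐ ω ∂P, ∀ n, ∃ k, n ≤ k ∧ 1 < W k ω := by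
    rw [ae_all_iff]
    intro n
    rw [ae_iff]
    have hsub : ∀ p, P {ω | ¬∃ k, n ≤ k ∧ 1 < W k ω} ≤ ρ ^ p := fun p => by
      refine (measure_mono fun ω hω => ?_).trans (hrun n p)
      simp only [Set.mem_ofPred_eq, not_exists, not_and, not_lt] at hω
      exact fun k hk => hω k hk.1
    exact le_antisymm (ge_of_tendsto' (ENNReal.tendsto_pow_atTop_nhds_zero_of_lt_one hρ) hsub)
      zero_le
  filter_upwards [hlong] with ω hω x
  -- Every holding time beyond `1` pushes the jump times further by `1`.
  have hgrow : ∀ N : ℕ, ∃ p, (N : ℝ≥0∞) ≤ arrival (fun k => W k ω) p := by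
    intro N
    induction N with
    | zero => exact ⟨0, by simp⟩
    | succ N ih =>
      obtain ⟨p, hp⟩ := ih
      obtain ⟨k, hk, hWk⟩ := hω p
      refine ⟨k + 1, ?_⟩
      rw [arrival, Finset.sum_range_succ]
      push_cast
      exact add_le_add (hp.trans (arrival_mono _ hk)) hWk.le
  obtain ⟨N, hN⟩ := ENNReal.exists_nat_gt (ENNReal.coe_ne_top (r := x))
  obtain ⟨p, hp⟩ := hgrow N
  exact ⟨p, hN.trans_le hp⟩

end ChainLaw

/-! ### The density of the path of the hidden chain -/

section ChainDensity

variable {M : ℕ}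

/-- The jump times of the path lie in `(0, τ)` and increase, and every jump changes the state. -/
def PathValid (h : HiddenPath M) (τ : ℝ) : Prop :=
  (∀ p, 0 < h.2.2 p ∧ h.2.2 p < τ) ∧ StrictMono h.2.2 ∧
    ∀ p : Fin h.1, h.2.1 p.castSucc ≠ h.2.1 p.succ

/-- The density of the path of the hidden chain up to time `τ`. -/
noncomputable def Params.chainDensity (θ : Params M) (h : HiddenPath M) (τ : ℝ) : ℝ≥0∞ :=
  ENNReal.ofReal (θ.ξ (h.2.1 0)) *
    (∏ p : Fin h.1, ENNReal.ofReal (θ.Q (h.2.1 p.castSucc) (h.2.1 p.succ))) *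
    ENNReal.ofReal (Real.exp (-∑ p : Fin (h.1 + 1), θ.q (h.2.1 p) *
      ((Fin.snoc h.2.2 τ : Fin (h.1 + 1) → ℝ) p - (Fin.cons 0 h.2.2 : Fin (h.1 + 1) → ℝ) p)))

theorem Params.jumpMatrix_mul_expDensity (θ : Params M) (a b : Fin M) {x : ℝ} (hx : 0 < x) :
    ENNReal.ofReal (θ.jumpMatrix a b) * expDensity (θ.q a) x =
      if a = b then 0 else ENNReal.ofReal (θ.Q a b) * ENNReal.ofReal (Real.exp (-(θ.q a * x))) := by
  rw [expDensity, Set.indicator_of_mem (show x ∈ Set.Ioi 0 from hx),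
    ← ENNReal.ofReal_mul (θ.jumpMatrix_nonneg a b), ← mul_assoc, θ.jumpMatrix_mul_q]
  split_ifs with h
  · simp
  · rw [ENNReal.ofReal_mul (θ.Q_nonneg a b h)]

theorem ae_ne_const {m : ℕ} (τ : ℝ) : ∀ᵐ u : Fin m → ℝ, ∀ p, u p ≠ τ := by
  rw [ae_all_iff]
  exact fun p => Measure.ae_eval_ne (fun _ => (volume : Measure ℝ)) p τ

/-- The contribution of the states `i` and the jump times `u` to the law of the path, when the
holding time of the last state reaches beyond `τ`. The rates of the exponential densities cancel the
denominators of the jump matrix; the null set of paths that jump at the time `τ` itself, which are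
not in `PathValid`, is left out. -/
theorem Params.jumpWeight_mul_density (θ : Params M) {m : ℕ} (i : Fin (m + 1) → Fin M) {τ : ℝ}
    (hτ : 0 ≤ τ) (g : ℝ≥0∞) {u : Fin m → ℝ} (hu : ∀ p, u p ≠ τ) :
    ENNReal.ofReal (θ.jumpWeight i) *
      ((∏ k : Fin m, expDensity (θ.q (i k.castSucc)) (increments u k)) *
        if (Fin.cons 0 u : Fin (m + 1) → ℝ) (Fin.last m) ≤ τ then
          ENNReal.ofReal (Real.exp (-(θ.q (i (Fin.last m)) *
            (τ - (Fin.cons 0 u : Fin (m + 1) → ℝ) (Fin.last m))))) * g else 0) =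
      {h : HiddenPath M | PathValid h τ}.indicator (fun h => θ.chainDensity h τ * g)
        ⟨m, i, u⟩ := by
  by_cases hpos : ∀ k, 0 < increments u k
  swap
  · have hinv : (⟨m, i, u⟩ : HiddenPath M) ∉ {h : HiddenPath M | PathValid h τ} := fun h =>
      hpos ((increments_pos_iff u).mpr ⟨fun k => (h.1 k).1, h.2.1⟩)
    rw [Set.indicator_of_notMem hinv]
    push Not at hpos
    obtain ⟨k, hk⟩ := hpos
    have : ∏ k : Fin m, expDensity (θ.q (i k.castSucc)) (increments u k) = 0 :=
      Finset.prod_eq_zero (Finset.mem_univ k) (Set.indicator_of_notMem (by simpa using hk) _)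
    simp [this]
  have hu' := (increments_pos_iff u).mp hpos
  by_cases hlast : (Fin.cons 0 u : Fin (m + 1) → ℝ) (Fin.last m) ≤ τ
  swap
  · have hinv : (⟨m, i, u⟩ : HiddenPath M) ∉ {h : HiddenPath M | PathValid h τ} := fun h => by
      cases m with
      | zero => exact hlast (by simpa using hτ)
      | succ m =>
        rw [← Fin.succ_last, Fin.cons_succ] at hlast
        exact hlast (h.1 (Fin.last m)).2.le
    rw [Set.indicator_of_notMem hinv, if_neg hlast, mul_zero, mul_zero]
  have hlt : ∀ p, u p < τ := by
    intro p
    cases m with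
    | zero => exact p.elim0
    | succ m =>
      rw [← Fin.succ_last, Fin.cons_succ] at hlast
      exact lt_of_le_of_ne ((hu'.2.monotone (Fin.le_last p)).trans hlast) (hu p)
  have hsplit : ENNReal.ofReal (θ.jumpWeight i) *
      ∏ k : Fin m, expDensity (θ.q (i k.castSucc)) (increments u k) =
      ENNReal.ofReal (θ.ξ (i 0)) * ∏ k : Fin m, if i k.castSucc = i k.succ then 0 else
        ENNReal.ofReal (θ.Q (i k.castSucc) (i k.succ)) *
          ENNReal.ofReal (Real.exp (-(θ.q (i k.castSucc) * increments u k))) := by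
    rw [Params.jumpWeight, ENNReal.ofReal_mul (θ.ξ_nonneg _),
      ENNReal.ofReal_prod_of_nonneg fun _ _ => θ.jumpMatrix_nonneg _ _, mul_assoc,
      ← Finset.prod_mul_distrib]
    congr 1
    exact Finset.prod_congr rfl fun k _ => θ.jumpMatrix_mul_expDensity _ _ (hpos k)
  rw [if_pos hlast, ← mul_assoc, hsplit]
  by_cases hs : ∀ p : Fin m, i p.castSucc ≠ i p.succ
  swap
  · have hinv : (⟨m, i, u⟩ : HiddenPath M) ∉ {h : HiddenPath M | PathValid h τ} := fun h =>
      hs h.2.2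
    rw [Set.indicator_of_notMem hinv]
    push Not at hs
    obtain ⟨k, hk⟩ := hs
    have h0 : (∏ k : Fin m, if i k.castSucc = i k.succ then 0 else
        ENNReal.ofReal (θ.Q (i k.castSucc) (i k.succ)) *
          ENNReal.ofReal (Real.exp (-(θ.q (i k.castSucc) * increments u k)))) = 0 :=
      Finset.prod_eq_zero (Finset.mem_univ k) (if_pos hk)
    rw [h0, mul_zero, zero_mul]
  have hval : (⟨m, i, u⟩ : HiddenPath M) ∈ {h : HiddenPath M | PathValid h τ} :=
    ⟨fun p => ⟨hu'.1 p, hlt p⟩, hu'.2, hs⟩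
  rw [Set.indicator_of_mem hval]
  simp only [hs, if_false, Params.chainDensity, Finset.prod_mul_distrib]
  rw [Fin.sum_univ_castSucc, neg_add, Real.exp_add, ENNReal.ofReal_mul (Real.exp_nonneg _),
    ← Finset.sum_neg_distrib, Real.exp_sum, ENNReal.ofReal_prod_of_nonneg fun _ _ =>
      Real.exp_nonneg _]
  simp only [Fin.snoc_castSucc, Fin.snoc_last, increments]
  ring

end ChainDensity

/-! ### The law of the path of the hidden chain up to a fixed time -/

section ChainPathLaw

variable {M : ℕ} {Ω : Type*} [MeasurableSpace Ω] {θ : Params M} {P : Measure Ω}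
  {S : ℝ → Ω → Fin M} {Y : ℕ → Ω → Fin M} {W : ℕ → Ω → ℝ≥0∞}

/-- The path of the hidden chain up to a fixed time `τ` has the density `chainDensity`. -/
theorem IsMarkovChain.lintegral_pathUpTo [IsProbabilityMeasure P] (hc : IsMarkovChain θ P S Y W)
    {τ : ℝ} (hτ : 0 ≤ τ) {G : HiddenPath M → ℝ≥0∞} (hG : Measurable G) :
    ∫⁻ ω, G (pathUpTo (fun k => Y k ω) (fun k => W k ω) (ENNReal.ofReal τ)) ∂P =
      ∑' m : ℕ, ∑ i : Fin (m + 1) → Fin M, ∫⁻ u : Fin m → ℝ,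
        {h : HiddenPath M | PathValid h τ}.indicator (fun h => θ.chainDensity h τ * G h)
          ⟨m, i, u⟩ := by
  classical
  let H : ∀ m, (Fin (m + 1) → Fin M) → (Fin (m + 1) → ℝ≥0∞) → ℝ≥0∞ := fun m i w =>
    if finArrival w m ≤ ENNReal.ofReal τ ∧ ENNReal.ofReal τ < finArrival w (m + 1) then
      G ⟨m, i, fun p : Fin m => (finArrival w (p + 1)).toReal⟩ else 0
  have hGm : ∀ m (i : Fin (m + 1) → Fin M), Measurable fun u : Fin m → ℝ => G ⟨m, i, u⟩ :=
    fun m i => (measurable_sigma_iff.mp hG m).comp (measurable_const.prodMk measurable_id)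
  have hH : ∀ m i, Measurable (H m i) := fun m i =>
    Measurable.ite ((measurableSet_le (measurable_finArrival _) measurable_const).inter
      (measurableSet_lt measurable_const (measurable_finArrival _)))
      ((hGm m i).comp (measurable_pi_lambda _ fun p => (measurable_finArrival _).ennreal_toReal))
      measurable_const
  have hW : ∀ m, Measurable fun ω (k : Fin (m + 1)) => W k ω := fun m =>
    measurable_pi_lambda _ fun k => hc.measurable_W k
  -- Almost surely exactly one number of jumps `m` and one sequence of states `i` contribute.
  have hpoint : ∀ᵐ ω ∂P, G (pathUpTo (fun k => Y k ω) (fun k => W k ω) (ENNReal.ofReal τ)) =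
      ∑' m : ℕ, ∑ i : Fin (m + 1) → Fin M,
        {ω | ∀ k : Fin (m + 1), Y k ω = i k}.indicator
          (fun ω => H m i fun k : Fin (m + 1) => W k ω) ω := by
    filter_upwards [hc.ae_nonExplosive] with ω hω
    obtain ⟨h₁, h₂⟩ := hω.jumpCount_spec (ENNReal.ofReal_ne_top (r := τ))
    set N := jumpCount (fun k => W k ω) (ENNReal.ofReal τ) with hN
    have harr : ∀ {n p : ℕ}, p ≤ n → finArrival (fun k : Fin n => W k ω) p =
        arrival (fun k => W k ω) p := fun hp => finArrival_eq_arrival hp fun k => W k ω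
    rw [tsum_eq_single N, Finset.sum_eq_single fun k : Fin (N + 1) => Y k ω]
    · rw [Set.indicator_of_mem (by simp)]
      simp only [H]
      rw [harr (Nat.le_succ _), harr le_rfl, if_pos ⟨h₁, h₂⟩]
      have : (fun p : Fin N => (finArrival (fun k : Fin (N + 1) => W k ω) (p + 1)).toReal) =
          fun p : Fin N => (arrival (fun k => W k ω) (p + 1)).toReal := by
        funext p
        rw [harr (by omega)]
      rw [this]
      rfl
    · intro i _ hi
      refine Set.indicator_of_notMem (fun h => hi ?_) _
      exact funext fun k => (h k).symm
    · simp
    · intro m hm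
      refine Finset.sum_eq_zero fun i _ => ?_
      refine Set.indicator_apply_eq_zero.mpr fun _ => if_neg ?_
      rw [harr (Nat.le_succ _), harr le_rfl]
      rintro ⟨h₃, h₄⟩
      exact hm (jumpCount_eq h₃ h₄).symm
  have hterm : ∀ m (i : Fin (m + 1) → Fin M), Measurable fun ω =>
      {ω | ∀ k : Fin (m + 1), Y k ω = i k}.indicator
          (fun ω => H m i fun k : Fin (m + 1) => W k ω) ω := fun m i =>
    ((hH m i).comp (hW m)).indicator (measurableSet_states hc i)
  rw [lintegral_congr_ae hpoint, lintegral_tsum fun m =>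
    (Finset.measurable_fun_sum _ fun i _ => hterm m i).aemeasurable]
  refine tsum_congr fun m => ?_
  rw [lintegral_finsetSum _ fun i _ => hterm m i]
  refine Finset.sum_congr rfl fun i _ => ?_
  rw [lintegral_indicator (measurableSet_states hc i),
    ← lintegral_map (μ := P.restrict {ω | ∀ k : Fin (m + 1), Y k ω = i k}) (hH m i) (hW m),
    hc.map_holdingTimes, lintegral_smul_measure]
  have := lintegral_pi_holdingLaw_jumps (r := fun k => θ.q (i k)) (fun k => θ.q_nonneg _) hτ
    (hGm m i)
  simp only [H]
  rw [this, smul_eq_mul, ← lintegral_const_mul' _ _ ENNReal.ofReal_ne_top]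
  refine lintegral_congr_ae ?_
  filter_upwards [ae_ne_const τ] with u hu
  rw [θ.jumpWeight_mul_density i hτ _ hu]
  rfl

end ChainPathLaw

/-! ### Waiting times with a given hazard rate -/

section Hazard

/-- The map `x ↦ e^{-x}` is `1`-Lipschitz on `[0, ∞)`, hence preserves absolute continuity. -/
theorem abs_exp_neg_sub_exp_neg_le {a b : ℝ} (ha : 0 ≤ a) (hb : 0 ≤ b) :
    |Real.exp (-a) - Real.exp (-b)| ≤ |a - b| := by
  wlog h : a ≤ b generalizing a b
  · rw [abs_sub_comm, abs_sub_comm a]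
    exact this hb ha (not_le.mp h).le
  have h1 : Real.exp (-b) ≤ Real.exp (-a) := Real.exp_le_exp.mpr (by linarith)
  rw [abs_of_nonneg (sub_nonneg.mpr h1), abs_of_nonpos (sub_nonpos.mpr h)]
  have h2 : Real.exp (-b) = Real.exp (-a) * Real.exp (-(b - a)) := by
    rw [← Real.exp_add]; ring_nf
  have h3 := Real.add_one_le_exp (-(b - a))
  have h4 : Real.exp (-a) ≤ 1 := Real.exp_le_one_iff.mpr (by linarith)
  have h5 := Real.exp_pos (-a)
  rw [h2]
  nlinarith

/-- A law on `(0, ∞]` with hazard rate `f` has density `f e^{-∫ f}`. As `f` is only integrable,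
this rests on the fundamental theorem of calculus for absolutely continuous functions. -/
theorem setLIntegral_hazard_density {f : ℝ → ℝ} {b : ℝ} (hb : 0 ≤ b)
    (hf : IntervalIntegrable f volume 0 b) (h0 : ∀ x, 0 < x → 0 ≤ f x) :
    ∫⁻ x in Set.Ioc 0 b, ENNReal.ofReal (f x * Real.exp (-∫ y in (0 : ℝ)..x, f y)) =
      ENNReal.ofReal (1 - Real.exp (-∫ y in (0 : ℝ)..b, f y)) := by
  let L : ℝ → ℝ := fun x => ∫ y in (0 : ℝ)..x, f y
  have hL0 : ∀ x, 0 ≤ x → 0 ≤ L x := fun x hx => by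
    simp only [L]
    rw [intervalIntegral.integral_of_le hx]
    exact setIntegral_nonneg measurableSet_Ioc fun y hy => h0 y hy.1
  have hLac : AbsolutelyContinuousOnInterval L 0 b :=
    hf.absolutelyContinuousOnInterval_intervalIntegral (by simp)
  have hac : AbsolutelyContinuousOnInterval (fun x => Real.exp (-L x)) 0 b := by
    rw [absolutelyContinuousOnInterval_iff] at hLac ⊢
    intro ε hε
    obtain ⟨δ, hδ, h⟩ := hLac ε hε
    refine ⟨δ, hδ, fun E hE hsum => lt_of_le_of_lt (Finset.sum_le_sum fun i hi => ?_) (h E hE hsum)⟩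
    have hmem := hE.1 i hi
    rw [Set.uIcc_of_le hb] at hmem
    exact abs_exp_neg_sub_exp_neg_le (hL0 _ hmem.1.1) (hL0 _ hmem.2.1)
  have hderiv : ∀ᵐ x, x ∈ Set.uIoc 0 b →
      deriv (fun x => Real.exp (-L x)) x = -(f x * Real.exp (-L x)) := by
    filter_upwards [hf.ae_hasDerivAt_integral] with x hx hxb
    have h1 : HasDerivAt L (f x) x := hx (Set.uIoc_subset_uIcc hxb) 0 (by simp)
    have h2 : HasDerivAt (fun x => Real.exp (-L x)) (Real.exp (-L x) * -f x) x := h1.neg.exp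
    rw [h2.deriv]
    ring
  have hint : IntervalIntegrable (fun x => -(f x * Real.exp (-L x))) volume 0 b :=
    hac.intervalIntegrable_deriv.congr_ae ((ae_restrict_iff' measurableSet_uIoc).mpr hderiv)
  have hint' : IntegrableOn (fun x => f x * Real.exp (-L x)) (Set.Ioc 0 b) := by
    have := hint.neg
    rw [intervalIntegrable_iff_integrableOn_Ioc_of_le hb] at this
    exact this.congr_fun (fun x _ => by simp) measurableSet_Ioc
  have hval : ∫ x in Set.Ioc 0 b, f x * Real.exp (-L x) = 1 - Real.exp (-L b) := by
    have h1 := hac.integral_deriv_eq_sub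
    rw [intervalIntegral.integral_congr_ae hderiv, intervalIntegral.integral_neg,
      intervalIntegral.integral_of_le hb] at h1
    simp only [L, intervalIntegral.integral_same, neg_zero, Real.exp_zero] at h1 ⊢
    linarith
  rw [← hval, ofReal_integral_eq_lintegral_ofReal hint']
  filter_upwards [ae_restrict_mem measurableSet_Ioc] with x hx
  exact mul_nonneg (h0 x hx.1) (Real.exp_nonneg _)

theorem measurable_intervalIntegral {E : Type*} [MeasurableSpace E] {a b : E → ℝ}
    (ha : Measurable a) (hb : Measurable b) {f : E × ℝ → ℝ} (hf : Measurable f) :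
    Measurable fun e => ∫ y in (a e)..(b e), f (e, y) := by
  have key : ∀ {a b : E → ℝ}, Measurable a → Measurable b →
      Measurable fun e => ∫ y in Set.Ioc (a e) (b e), f (e, y) := by
    intro a b ha hb
    have hs : MeasurableSet {z : E × ℝ | a z.1 < z.2 ∧ z.2 ≤ b z.1} :=
      (measurableSet_lt (ha.comp measurable_fst) measurable_snd).inter
        (measurableSet_le measurable_snd (hb.comp measurable_fst))
    have h : StronglyMeasurable fun e => ∫ y, {z : E × ℝ | a z.1 < z.2 ∧ z.2 ≤ b z.1}.indicator f
        (e, y) := (hf.indicator hs).stronglyMeasurable.integral_prod_right'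
    have heq : (fun e => ∫ y in Set.Ioc (a e) (b e), f (e, y)) =
        fun e => ∫ y, {z : E × ℝ | a z.1 < z.2 ∧ z.2 ≤ b z.1}.indicator f (e, y) := by
      funext e
      rw [← integral_indicator measurableSet_Ioc]
      refine integral_congr_ae (Filter.Eventually.of_forall fun y => ?_)
      simp [Set.indicator_apply]
    rw [heq]
    exact h.measurable
  simp only [intervalIntegral]
  exact (key ha hb).sub (key hb ha)

/-- If a waiting time `V` has hazard rate `rate (H ω) ·` given `H` on the event `A`, then given `H`
it has the corresponding density. -/
theorem lintegral_of_hazard {Ω E : Type*} [MeasurableSpace Ω] [MeasurableSpace E] {P : Measure Ω}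
    [IsProbabilityMeasure P] {H : Ω → E} (hH : Measurable H) {A : Set Ω} (hA : MeasurableSet A)
    {V : Ω → ℝ≥0∞} (hV : Measurable V) {rate : E × ℝ → ℝ} (hrate : Measurable rate)
    (hrate0 : ∀ e x, 0 < x → 0 ≤ rate (e, x))
    (hint : ∀ e b, IntervalIntegrable (fun y => rate (e, y)) volume 0 b)
    (hhaz : ∀ B : Set E, MeasurableSet B → ∀ x : ℝ≥0, P (H ⁻¹' B ∩ A ∩ {ω | (x : ℝ≥0∞) < V ω}) =
      ∫⁻ ω in H ⁻¹' B ∩ A, ENNReal.ofReal (Real.exp (-∫ y in (0 : ℝ)..x, rate (H ω, y))) ∂P)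
    {F : E × ℝ → ℝ≥0∞} (hF : Measurable F) :
    ∫⁻ ω in A ∩ {ω | V ω < ∞}, F (H ω, (V ω).toReal) ∂P =
      ∫⁻ ω in A, (∫⁻ v in Set.Ioi (0 : ℝ), F (H ω, v) *
        ENNReal.ofReal (rate (H ω, v) * Real.exp (-∫ y in (0 : ℝ)..v, rate (H ω, y)))) ∂P := by
  have hcum : Measurable fun z : E × ℝ => ∫ y in (0 : ℝ)..z.2, rate (z.1, y) :=
    measurable_intervalIntegral (f := fun z : (E × ℝ) × ℝ => rate (z.1.1, z.2)) measurable_const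
      measurable_snd (by fun_prop)
  let d : E × ℝ → ℝ≥0∞ := fun z => (Set.univ ×ˢ Set.Ioi (0 : ℝ)).indicator (fun z =>
    ENNReal.ofReal (rate z * Real.exp (-∫ y in (0 : ℝ)..z.2, rate (z.1, y)))) z
  have hd : Measurable d := Measurable.indicator (by fun_prop)
    (MeasurableSet.univ.prod measurableSet_Ioi)
  have hHV : Measurable fun ω => (H ω, (V ω).toReal) := hH.prodMk hV.ennreal_toReal
  have hrest : ∀ B : Set E, MeasurableSet B → ((P.restrict A).map H).restrict B =
      (P.restrict (H ⁻¹' B ∩ A)).map H := fun B hB => by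
    rw [Measure.restrict_map hH hB, Measure.restrict_restrict (hH hB)]
  -- The joint law of the past and the waiting time, on the event that the latter is finite.
  have key : (P.restrict (A ∩ {ω | V ω < ∞})).map (fun ω => (H ω, (V ω).toReal)) =
      (((P.restrict A).map H).prod volume).withDensity d := by
    refine Measure.ext_prod fun {B} {C} hB hC => ?_
    -- For fixed `B` it is enough to compare the rectangles `B × (-∞, b]`.
    have hline : (((P.restrict (A ∩ {ω | V ω < ∞})).map (fun ω => (H ω, (V ω).toReal))).restrict
        (B ×ˢ Set.univ)).map Prod.snd =
        (((((P.restrict A).map H).prod volume).withDensity d).restrict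
          (B ×ˢ Set.univ)).map Prod.snd := by
      refine Measure.ext_of_Iic _ _ fun b => ?_
      have hBb : MeasurableSet (B ×ˢ Set.Iic b) := hB.prod measurableSet_Iic
      have hset : Prod.snd ⁻¹' Set.Iic b ∩ B ×ˢ Set.univ = B ×ˢ Set.Iic b := by
        ext z; simp [and_comm]
      rw [Measure.map_apply measurable_snd measurableSet_Iic,
        Measure.map_apply measurable_snd measurableSet_Iic,
        Measure.restrict_apply (measurable_snd measurableSet_Iic),
        Measure.restrict_apply (measurable_snd measurableSet_Iic), hset,
        Measure.map_apply hHV hBb, Measure.restrict_apply (hHV hBb), withDensity_apply _ hBb,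
        ← Measure.prod_restrict, lintegral_prod _ hd.aemeasurable, hrest B hB,
        lintegral_map hd.lintegral_prod_right' hH]
      have hdI : ∀ e, ∫⁻ v in Set.Iic b, d (e, v) = ∫⁻ v in Set.Ioc 0 b, ENNReal.ofReal
          (rate (e, v) * Real.exp (-∫ y in (0 : ℝ)..v, rate (e, y))) := by
        intro e
        have : (fun v => d (e, v)) = (Set.Ioi (0 : ℝ)).indicator fun v => ENNReal.ofReal
          (rate (e, v) * Real.exp (-∫ y in (0 : ℝ)..v, rate (e, y))) := by
          funext v
          simp [d, Set.indicator_apply]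
        rw [this, setLIntegral_indicator measurableSet_Ioi]
        rfl
      simp_rw [hdI]
      rcases lt_or_ge b 0 with hb | hb
      · have h1 : (fun ω => (H ω, (V ω).toReal)) ⁻¹' B ×ˢ Set.Iic b = ∅ := by
          ext ω
          simp only [Set.mem_preimage, Set.mem_prod, Set.mem_Iic, Set.mem_empty_iff_false,
            iff_false, not_and, not_le]
          exact fun _ => hb.trans_le ENNReal.toReal_nonneg
        rw [h1, Set.Ioc_eq_empty (not_lt.mpr hb.le)]
        simp
      · lift b to ℝ≥0 using hb
        have h1 : (fun ω => (H ω, (V ω).toReal)) ⁻¹' B ×ˢ Set.Iic (b : ℝ) ∩ (A ∩ {ω | V ω < ∞}) =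
            (H ⁻¹' B ∩ A) \ (H ⁻¹' B ∩ A ∩ {ω | (b : ℝ≥0∞) < V ω}) := by
          ext ω
          have h2 : ((V ω).toReal ≤ b ∧ V ω < ∞) ↔ V ω ≤ b := by
            constructor
            · rintro ⟨h, h'⟩
              have h3 := ENNReal.ofReal_le_ofReal h
              rwa [ENNReal.ofReal_toReal h'.ne, ENNReal.ofReal_coe_nnreal] at h3
            · intro h
              exact ⟨ENNReal.toReal_le_coe_of_le_coe h, h.trans_lt ENNReal.coe_lt_top⟩
          simp only [Set.mem_inter_iff, Set.mem_preimage, Set.mem_prod, Set.mem_Iic,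
            Set.mem_ofPred_eq, Set.mem_sdiff, not_and, not_lt]
          tauto
        have hS : MeasurableSet (H ⁻¹' B ∩ A) := (hH hB).inter hA
        have hb2 : Measurable fun ω => ∫ y in (0 : ℝ)..b, rate (H ω, y) :=
          hcum.comp (hH.prodMk measurable_const)
        rw [h1, measure_sdiff Set.inter_subset_left
          (hS.inter (measurableSet_lt measurable_const hV)).nullMeasurableSet
          (measure_ne_top _ _), hhaz B hB b, ← setLIntegral_one (H ⁻¹' B ∩ A), ← lintegral_sub']
        · refine lintegral_congr fun ω => ?_
          rw [setLIntegral_hazard_density b.coe_nonneg (hint _ _) (hrate0 _),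
            ENNReal.ofReal_sub _ (Real.exp_nonneg _), ENNReal.ofReal_one]
        · exact Measurable.aemeasurable (by fun_prop)
        · rw [← hhaz B hB b]
          exact measure_ne_top _ _
        · refine Filter.Eventually.of_forall fun ω => ?_
          rw [ENNReal.ofReal_le_one, Real.exp_le_one_iff, neg_nonpos,
            intervalIntegral.integral_of_le b.coe_nonneg]
          exact setIntegral_nonneg measurableSet_Ioc fun y hy => hrate0 _ _ hy.1
    have h := congrArg (fun m : Measure ℝ => m C) hline
    have hset : Prod.snd ⁻¹' C ∩ B ×ˢ Set.univ = B ×ˢ C := by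
      ext z; simp [and_comm]
    rwa [Measure.map_apply measurable_snd hC, Measure.map_apply measurable_snd hC,
      Measure.restrict_apply (measurable_snd hC), Measure.restrict_apply (measurable_snd hC),
      hset] at h
  rw [← lintegral_map hF hHV, key, lintegral_withDensity_eq_lintegral_mul _ hd hF,
    lintegral_prod _ (hd.mul hF).aemeasurable, lintegral_map (hd.mul hF).lintegral_prod_right' hH]
  refine lintegral_congr fun ω => ?_
  rw [← lintegral_indicator measurableSet_Ioi]
  refine lintegral_congr fun v => ?_
  by_cases hv : 0 < v
  · simp [d, hv, mul_comm]
  · simp [d, hv]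

end Hazard

/-! ### Intensities and the density of the event times -/

section Intensity

variable {M : ℕ} (θ : Params M)

theorem Params.intensity_eq (s : ℝ → Fin M) {n : ℕ} (t : Fin n → ℝ) (x : ℝ) :
    θ.intensity s t x = θ.stateIntensity t (s x) x := by
  simp [Params.intensity]

theorem Params.stateIntensity_nonneg {n : ℕ} (t : Fin n → ℝ) (i : Fin M) (x : ℝ) :
    0 ≤ θ.stateIntensity t i x := by
  refine add_nonneg (θ.μ_nonneg i) (Finset.sum_nonneg fun k _ => ?_)
  split_ifs with h
  · exact θ.φ_nonneg i _ (sub_pos.mpr h)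
  · exact le_rfl

theorem Params.measurable_stateIntensity {n : ℕ} (i : Fin M) :
    Measurable fun z : (Fin n → ℝ) × ℝ => θ.stateIntensity z.1 i z.2 := by
  have := θ.φ_measurable i
  refine measurable_const.add (Finset.measurable_fun_sum _ fun k _ => ?_)
  exact Measurable.ite (measurableSet_lt (by fun_prop) measurable_snd) (by fun_prop)
    measurable_const

theorem Params.intervalIntegrable_stateIntensity {n : ℕ} (t : Fin n → ℝ) (i : Fin M) (a b : ℝ) :
    IntervalIntegrable (θ.stateIntensity t i) volume a b := by
  have hterm : ∀ k c, IntegrableOn (fun x => if t k < x then θ.φ i (x - t k) else 0)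
      (Set.Iic c) := by
    intro k c
    have h1 : (fun x => if t k < x then θ.φ i (x - t k) else 0) =
        (Set.Ioi (t k)).indicator fun x => θ.φ i (x - t k) := by
      funext x
      simp [Set.indicator_apply]
    rw [h1, integrableOn_indicator_iff measurableSet_Ioi]
    have h2 : Set.Ioi (t k) ∩ Set.Iic c = (fun x => x - t k) ⁻¹' Set.Ioc 0 (c - t k) := by
      ext x; simp
    rw [h2]
    exact ((measurePreserving_sub_right volume (t k)).integrableOn_comp_preimage
      (measurableEmbedding_subRight (t k))).mpr (θ.φ_integrable i _)
  refine IntervalIntegrable.add (by simp) ?_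
  have : IntegrableOn (fun x => ∑ k, if t k < x then θ.φ i (x - t k) else 0)
      (Set.uIoc a b) :=
    integrable_finsetSum _ fun k _ => (hterm k (max a b)).mono_set fun x hx => hx.2
  exact intervalIntegrable_iff.mpr this

theorem Params.intervalIntegrable_stateIntensity_ite {s : ℝ → Fin M} (hs : Measurable s) {n : ℕ}
    (t : Fin n → ℝ) (i : Fin M) (a b : ℝ) :
    IntervalIntegrable (fun x => if s x = i then θ.stateIntensity t i x else 0) volume a b := by
  have h1 : (fun x => if s x = i then θ.stateIntensity t i x else 0) =
      (s ⁻¹' {i}).indicator (θ.stateIntensity t i) := by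
    funext x
    split_ifs with h
    · rw [Set.indicator_of_mem (show x ∈ s ⁻¹' {i} from h)]
    · rw [Set.indicator_of_notMem (show x ∉ s ⁻¹' {i} from h)]
  rw [h1, intervalIntegrable_iff]
  exact (intervalIntegrable_iff.mp (θ.intervalIntegrable_stateIntensity t i a b)).indicator
    (hs (measurableSet_singleton i))

theorem Params.intervalIntegrable_intensity {s : ℝ → Fin M} (hs : Measurable s) {n : ℕ}
    (t : Fin n → ℝ) (a b : ℝ) : IntervalIntegrable (θ.intensity s t) volume a b :=
  intervalIntegrable_iff.mpr (integrable_finsetSum _ fun i _ =>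
    intervalIntegrable_iff.mp (θ.intervalIntegrable_stateIntensity_ite hs t i a b))

/-- The last event time `t_n` (with `t_0 = 0`). -/
def endTime {n : ℕ} (t : Fin n → ℝ) : ℝ := (Fin.cons 0 t : Fin (n + 1) → ℝ) (Fin.last n)

theorem measurable_endTime {n : ℕ} : Measurable (endTime : (Fin n → ℝ) → ℝ) :=
  measurable_cons_apply (Fin.last n)

@[simp]
theorem endTime_succ {n : ℕ} (t : Fin (n + 1) → ℝ) : endTime t = t (Fin.last n) := by
  rw [endTime, ← Fin.succ_last, Fin.cons_succ]

theorem CompleteData.horizon_eq {K : ℕ} (c : CompleteData M K) : c.horizon = endTime c.t := by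
  cases K with
  | zero => simp [CompleteData.horizon, endTime]
  | succ K =>
    rw [endTime_succ, CompleteData.horizon, dif_pos (Nat.succ_pos K)]
    rfl

/-- Later events do not influence the intensity. -/
theorem Params.stateIntensity_init {n : ℕ} (t : Fin (n + 1) → ℝ) (i : Fin M) {x : ℝ}
    (hx : x ≤ t (Fin.last n)) : θ.stateIntensity t i x = θ.stateIntensity (Fin.init t) i x := by
  simp only [Params.stateIntensity, Fin.sum_univ_castSucc, if_neg (not_lt.mpr hx), add_zero]
  rfl

/-- The density at `v` of the next event time after the events `t`, given the path `s`. -/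
noncomputable def Params.nextDensity (s : ℝ → Fin M) {n : ℕ} (t : Fin n → ℝ) (v : ℝ) : ℝ≥0∞ :=
  (Set.Ioi (endTime t)).indicator (fun v => ENNReal.ofReal (θ.intensity s t v *
    Real.exp (-∫ y in (endTime t)..v, θ.intensity s t y))) v

/-- The density of the first `n` event times given the path `s`, by recursion on `n`. -/
noncomputable def Params.eventDensity (s : ℝ → Fin M) : ∀ n, (Fin n → ℝ) → ℝ≥0∞
  | 0, _ => 1
  | n + 1, t => Params.eventDensity s n (Fin.init t) *
      θ.nextDensity s (Fin.init t) (t (Fin.last n))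

/-- The event times are positive and increase. -/
def TimesValid {n : ℕ} (t : Fin n → ℝ) : Prop := (∀ k, 0 < t k) ∧ StrictMono t

theorem timesValid_succ_iff {n : ℕ} (t : Fin (n + 1) → ℝ) :
    TimesValid t ↔ TimesValid (Fin.init t) ∧ endTime (Fin.init t) < t (Fin.last n) := by
  simp only [TimesValid, ← increments_pos_iff]
  rw [Fin.forall_fin_succ']
  refine and_congr (forall_congr' fun k => ?_) ?_
  · have : increments t k.castSucc = increments (Fin.init t) k := by
      simp only [increments, Fin.init]
      congr 1
      obtain ⟨k, hk⟩ := k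
      cases k <;> rfl
    rw [this]
  · rw [increments, sub_pos, endTime]
    cases n <;> rfl

theorem TimesValid.endTime_nonneg {n : ℕ} {t : Fin n → ℝ} (ht : TimesValid t) : 0 ≤ endTime t := by
  cases n with
  | zero => simp [endTime]
  | succ n => rw [endTime_succ]; exact (ht.1 _).le

theorem TimesValid.le_endTime {n : ℕ} {t : Fin n → ℝ} (ht : TimesValid t) (k : Fin n) :
    t k ≤ endTime t := by
  cases n with
  | zero => exact k.elim0
  | succ n => rw [endTime_succ]; exact ht.2.monotone (Fin.le_last k)

theorem Params.eventDensity_of_not_valid (s : ℝ → Fin M) {n : ℕ} {t : Fin n → ℝ}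
    (ht : ¬TimesValid t) : θ.eventDensity s n t = 0 := by
  induction n with
  | zero => exact absurd ⟨fun k => k.elim0, fun k => k.elim0⟩ ht
  | succ n ih =>
    rw [timesValid_succ_iff, not_and_or] at ht
    rw [Params.eventDensity]
    rcases ht with h | h
    · rw [ih h, zero_mul]
    · rw [Params.nextDensity, Set.indicator_of_notMem (by simpa using h), mul_zero]

/-- The exponents of the successive waiting times add up to the integral over `[0, t_n]`, as the
intensity up to an event time does not involve that event and the later ones. -/
theorem Params.eventDensity_eq {s : ℝ → Fin M} (hs : Measurable s) {n : ℕ} {t : Fin n → ℝ}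
    (ht : TimesValid t) : θ.eventDensity s n t =
      (∏ k, ENNReal.ofReal (θ.stateIntensity t (s (t k)) (t k))) *
        ENNReal.ofReal (Real.exp (-∫ y in (0 : ℝ)..(endTime t), θ.intensity s t y)) := by
  induction n with
  | zero => simp [Params.eventDensity, endTime]
  | succ n ih =>
    obtain ⟨hinit, hlast⟩ := (timesValid_succ_iff t).mp ht
    rw [Params.eventDensity, ih hinit, Params.nextDensity,
      Set.indicator_of_mem (by simpa using hlast), endTime_succ, Fin.prod_univ_castSucc]
    have h1 : ∀ k : Fin n, θ.stateIntensity t (s (t k.castSucc)) (t k.castSucc) =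
        θ.stateIntensity (Fin.init t) (s (Fin.init t k)) (Fin.init t k) := fun k =>
      θ.stateIntensity_init t _ (ht.2.monotone (Fin.le_last _))
    have h2 : ∫ y in (0 : ℝ)..(t (Fin.last n)), θ.intensity s t y =
        ∫ y in (0 : ℝ)..(t (Fin.last n)), θ.intensity s (Fin.init t) y := by
      refine intervalIntegral.integral_congr fun y hy => ?_
      rw [Set.uIcc_of_le (ht.1 _).le] at hy
      simp only [θ.intensity_eq, θ.stateIntensity_init t _ hy.2]
    have h3 := intervalIntegral.integral_add_adjacent_intervals
      (θ.intervalIntegrable_intensity hs (Fin.init t) 0 (endTime (Fin.init t)))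
      (θ.intervalIntegrable_intensity hs (Fin.init t) (endTime (Fin.init t)) (t (Fin.last n)))
    simp_rw [h1]
    rw [h2, ← h3, neg_add, Real.exp_add, ENNReal.ofReal_mul (Real.exp_nonneg _), θ.intensity_eq,
      ENNReal.ofReal_mul (θ.stateIntensity_nonneg _ _ _), θ.stateIntensity_init t _ le_rfl]
    ring

end Intensity

/-! ### Measurability of intensities and densities -/

section HawkesLaw

variable {M : ℕ}

/-- The state at time `x` of a path with jump chain `z.1` and holding times `z.2`, defined for every
`z` and jointly measurable; it is the right state as long as the path is not explosive. -/
noncomputable def pathState (z : (ℕ → Fin M) × (ℕ → ℝ≥0∞)) (x : ℝ) : Fin M :=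
  z.1 (jumpCount z.2 (ENNReal.ofReal x))

theorem measurable_pathState :
    Measurable fun p : ((ℕ → Fin M) × (ℕ → ℝ≥0∞)) × ℝ => pathState p.1 p.2 := by
  have hN : Measurable fun p : ((ℕ → Fin M) × (ℕ → ℝ≥0∞)) × ℝ =>
      jumpCount p.1.2 (ENNReal.ofReal p.2) :=
    measurable_jumpCount.comp (f := fun p : ((ℕ → Fin M) × (ℕ → ℝ≥0∞)) × ℝ =>
      (p.1.2, ENNReal.ofReal p.2)) (by fun_prop)
  refine measurable_to_countable' fun i => ?_
  have : (fun p : ((ℕ → Fin M) × (ℕ → ℝ≥0∞)) × ℝ => pathState p.1 p.2) ⁻¹' {i} =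
      ⋃ n, {p | jumpCount p.1.2 (ENNReal.ofReal p.2) = n} ∩ {p | p.1.1 n = i} := by
    ext p
    simp [pathState]
  rw [this]
  have hY : ∀ n, Measurable fun p : ((ℕ → Fin M) × (ℕ → ℝ≥0∞)) × ℝ => p.1.1 n := fun n => by
    fun_prop
  exact MeasurableSet.iUnion fun n => (hN (measurableSet_singleton n)).inter
    (hY n (measurableSet_singleton i))

theorem measurable_pathState_right (z : (ℕ → Fin M) × (ℕ → ℝ≥0∞)) : Measurable (pathState z) :=
  measurable_pathState.comp measurable_prodMk_left

section Measurability

variable (θ : Params M) {E : Type*} [MeasurableSpace E] {σ : E → ℝ → Fin M}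

theorem Params.measurable_intensity (hσ : Measurable fun p : E × ℝ => σ p.1 p.2) {n : ℕ} :
    Measurable fun p : (E × (Fin n → ℝ)) × ℝ => θ.intensity (σ p.1.1) p.1.2 p.2 := by
  refine Finset.measurable_fun_sum _ fun i _ => Measurable.ite ?_ ?_ measurable_const
  · exact (hσ.comp (f := fun p : (E × (Fin n → ℝ)) × ℝ => (p.1.1, p.2)) (by fun_prop))
      (measurableSet_singleton i)
  · exact (θ.measurable_stateIntensity i).comp
      (f := fun p : (E × (Fin n → ℝ)) × ℝ => (p.1.2, p.2)) (by fun_prop)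

theorem Params.measurable_nextDensity (hσ : Measurable fun p : E × ℝ => σ p.1 p.2) {n : ℕ} :
    Measurable fun p : (E × (Fin n → ℝ)) × ℝ => θ.nextDensity (σ p.1.1) p.1.2 p.2 := by
  have hend : Measurable fun p : (E × (Fin n → ℝ)) × ℝ => endTime p.1.2 :=
    measurable_endTime.comp (by fun_prop)
  have hint : Measurable fun p : (E × (Fin n → ℝ)) × ℝ =>
      ∫ y in (endTime p.1.2)..p.2, θ.intensity (σ p.1.1) p.1.2 y :=
    measurable_intervalIntegral (f := fun r : ((E × (Fin n → ℝ)) × ℝ) × ℝ =>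
      θ.intensity (σ r.1.1.1) r.1.1.2 r.2) hend measurable_snd
      ((θ.measurable_intensity hσ).comp
        (f := fun r : ((E × (Fin n → ℝ)) × ℝ) × ℝ => (r.1.1, r.2)) (by fun_prop))
  have heq : (fun p : (E × (Fin n → ℝ)) × ℝ => θ.nextDensity (σ p.1.1) p.1.2 p.2) =
      {p | endTime p.1.2 < p.2}.indicator fun p =>
        ENNReal.ofReal (θ.intensity (σ p.1.1) p.1.2 p.2 *
          Real.exp (-∫ y in (endTime p.1.2)..p.2, θ.intensity (σ p.1.1) p.1.2 y)) := by
    funext p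
    simp [Params.nextDensity, Set.indicator_apply]
  rw [heq]
  refine Measurable.indicator ?_ (measurableSet_lt hend measurable_snd)
  exact ((θ.measurable_intensity hσ).mul hint.neg.exp).ennreal_ofReal

theorem Params.measurable_eventDensity (hσ : Measurable fun p : E × ℝ => σ p.1 p.2) (n : ℕ) :
    Measurable fun p : E × (Fin n → ℝ) => θ.eventDensity (σ p.1) n p.2 := by
  induction n with
  | zero => exact measurable_const
  | succ n ih =>
    have hinit : Measurable fun t : Fin (n + 1) → ℝ => Fin.init t :=
      measurable_pi_lambda _ fun k => measurable_pi_apply _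
    exact (ih.comp (f := fun p : E × (Fin (n + 1) → ℝ) => (p.1, Fin.init p.2)) (by fun_prop)).mul
      ((θ.measurable_nextDensity hσ).comp (f := fun p : E × (Fin (n + 1) → ℝ) =>
        ((p.1, Fin.init p.2), p.2 (Fin.last n))) (by fun_prop))

end Measurability

end HawkesLaw

/-! ### The past of the process -/

section History

variable {M : ℕ} {Ω : Type*} {Y : ℕ → Ω → Fin M} {W T : ℕ → Ω → ℝ≥0∞}

/-- The jump chain and the holding times of the hidden chain, as one random element. -/
def chainOf (Y : ℕ → Ω → Fin M) (W : ℕ → Ω → ℝ≥0∞) (ω : Ω) : (ℕ → Fin M) × (ℕ → ℝ≥0∞) :=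
  (fun k => Y k ω, fun k => W k ω)

/-- The first `n` event times. -/
noncomputable def eventTimes (T : ℕ → Ω → ℝ≥0∞) (n : ℕ) (ω : Ω) (k : Fin n) : ℝ :=
  (T (k + 1) ω).toReal

theorem measurable_T_history {n k : ℕ} (hk : k ≤ n) : Measurable[history Y W T n] (T k) := by
  refine (comap_measurable (T k)).mono ?_ le_rfl
  exact le_sup_of_le_right
    (le_iSup₂_of_le k (Finset.mem_range.mpr (Nat.lt_succ_of_le hk)) le_rfl)

theorem measurable_chainOf_history (n : ℕ) : Measurable[history Y W T n] (chainOf Y W) := by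
  have hY : ∀ k, Measurable[history Y W T n] (Y k) := fun k =>
    (comap_measurable (Y k)).mono
      (le_sup_of_le_left (le_iSup_of_le k le_sup_left)) le_rfl
  have hW : ∀ k, Measurable[history Y W T n] (W k) := fun k =>
    (comap_measurable (W k)).mono
      (le_sup_of_le_left (le_iSup_of_le k le_sup_right)) le_rfl
  let := history Y W T n
  exact (measurable_pi_lambda _ fun k => hY k).prodMk (measurable_pi_lambda _ fun k => hW k)

theorem measurable_eventTimes_history (n : ℕ) :
    Measurable[history Y W T n] (eventTimes T n) := by
  let := history Y W T n
  exact measurable_pi_lambda _ fun k => (measurable_T_history k.2).ennreal_toReal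

end History

/-! ### The law of the event times given the hidden chain -/

section EventLaw

variable {M : ℕ} {Ω : Type*} [mΩ : MeasurableSpace Ω] {θ : Params M} {P : Measure Ω}
  {S : ℝ → Ω → Fin M} {Y : ℕ → Ω → Fin M} {W T : ℕ → Ω → ℝ≥0∞}

theorem IsMarkovChain.measurable_chainOf (hc : IsMarkovChain θ P S Y W) :
    Measurable (chainOf Y W) :=
  (measurable_pi_lambda _ fun k => hc.measurable_Y k).prodMk
    (measurable_pi_lambda _ fun k => hc.measurable_W k)

theorem IsMMHP.measurable_eventTimes (hN : IsMMHP θ P S Y W T) (n : ℕ) :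
    Measurable (eventTimes T n) :=
  measurable_pi_lambda _ fun _ => (hN.measurable_T _).ennreal_toReal

/-- The hidden chain is almost surely the path built from its jump chain and holding times. -/
theorem IsMarkovChain.ae_eq_pathState [IsProbabilityMeasure P] (hc : IsMarkovChain θ P S Y W) :
    ∀ᵐ ω ∂P, ∀ x, 0 ≤ x → S x ω = pathState (chainOf Y W ω) x := by
  filter_upwards [hc.path, hc.ae_nonExplosive] with ω hpath hω x hx
  obtain ⟨h₁, h₂⟩ := hω.jumpCount_spec (ENNReal.ofReal_ne_top (r := x))
  exact hpath _ x hx h₁ h₂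

theorem IsMMHP.toReal_T_eq_endTime (hN : IsMMHP θ P S Y W T) (n : ℕ) (ω : Ω) :
    (T n ω).toReal = endTime (eventTimes T n ω) := by
  cases n with
  | zero => simp [hN.T_zero, endTime]
  | succ n => rw [endTime_succ]; rfl

theorem IsMMHP.history_le (hN : IsMMHP θ P S Y W T) (n : ℕ) : history Y W T n ≤ mΩ := by
  refine sup_le (iSup_le fun k => sup_le ?_ ?_) (iSup₂_le fun k _ => ?_)
  · exact (hN.chain.measurable_Y k).comap_le
  · exact (hN.chain.measurable_W k).comap_le
  · exact (hN.measurable_T k).comap_le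

/-- The hazard condition, integrated over an event that is determined by the past. -/
theorem IsMMHP.measure_waiting [IsProbabilityMeasure P] (hN : IsMMHP θ P S Y W T) (n : ℕ)
    {B : Set (((ℕ → Fin M) × (ℕ → ℝ≥0∞)) × (Fin n → ℝ))} (hB : MeasurableSet B) (x : ℝ≥0) :
    P ((fun ω => (chainOf Y W ω, eventTimes T n ω)) ⁻¹' B ∩ {ω | T n ω < ∞} ∩
        {ω | (x : ℝ≥0∞) < T (n + 1) ω - T n ω}) =
      ∫⁻ ω in (fun ω => (chainOf Y W ω, eventTimes T n ω)) ⁻¹' B ∩ {ω | T n ω < ∞},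
        ENNReal.ofReal (Real.exp (-∫ y in (0 : ℝ)..x, θ.intensity (pathState (chainOf Y W ω))
          (eventTimes T n ω) (endTime (eventTimes T n ω) + y))) ∂P := by
  set A := (fun ω => (chainOf Y W ω, eventTimes T n ω)) ⁻¹' B ∩ {ω | T n ω < ∞} with hAdef
  have hA' : MeasurableSet[history Y W T n] A := by
    let := history Y W T n
    exact ((measurable_chainOf_history n).prodMk (measurable_eventTimes_history n) hB).inter
      (measurableSet_lt (measurable_T_history le_rfl) measurable_const)
  have hA : MeasurableSet A := hN.history_le n _ hA'
  have hC : MeasurableSet {ω | T n ω + x < T (n + 1) ω} :=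
    measurableSet_lt ((hN.measurable_T n).add measurable_const) (hN.measurable_T (n + 1))
  have hset : A ∩ {ω | (x : ℝ≥0∞) < T (n + 1) ω - T n ω} = A ∩ {ω | T n ω + x < T (n + 1) ω} := by
    ext ω
    simp only [Set.mem_inter_iff, Set.mem_ofPred_eq]
    exact and_congr_right fun _ => by rw [lt_tsub_iff_left]
  have hexp : ∀ᵐ ω ∂(P.restrict A), condExp (history Y W T n) P
        ({ω' | T n ω' + x < T (n + 1) ω'}.indicator fun _ => (1 : ℝ)) ω =
      Real.exp (-∫ y in (0 : ℝ)..x, θ.intensity (pathState (chainOf Y W ω))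
          (eventTimes T n ω) (endTime (eventTimes T n ω) + y)) := by
    -- On `A` the past determines the last event time, and `S` is the path built from `Y` and `W`.
    rw [ae_restrict_iff' hA]
    filter_upwards [hN.hazard n x, hN.chain.ae_eq_pathState] with ω h hS hωA
    rw [h hωA.2, hN.toReal_T_eq_endTime]
    have h0 : 0 ≤ endTime (eventTimes T n ω) := by
      rw [← hN.toReal_T_eq_endTime]
      exact ENNReal.toReal_nonneg
    rw [intervalIntegral.integral_comp_add_left
      (fun y => θ.intensity (pathState (chainOf Y W ω)) (eventTimes T n ω) y), add_zero]
    congr 2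
    refine intervalIntegral.integral_congr fun y hy => ?_
    rw [Set.uIcc_of_le (by simp)] at hy
    simp only [θ.intensity_eq]
    rw [hS y (h0.trans hy.1)]
    rfl
  have hind : Integrable ({ω' | T n ω' + x < T (n + 1) ω'}.indicator fun _ => (1 : ℝ)) P :=
    (integrable_const 1).indicator hC
  have hintegral := setIntegral_condExp (hN.history_le n) hind hA'
  rw [integral_congr_ae hexp, setIntegral_indicator hC, setIntegral_const, smul_eq_mul,
    mul_one] at hintegral
  have hintble := (integrable_condExp (μ := P) (m := history Y W T n)
    (f := {ω' | T n ω' + x < T (n + 1) ω'}.indicator fun _ => (1 : ℝ))).integrableOn (s := A)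
  rw [hset, ← ofReal_measureReal (measure_ne_top _ _), ← hintegral,
    ofReal_integral_eq_lintegral_ofReal (hintble.congr hexp)
      (Filter.Eventually.of_forall fun _ => Real.exp_nonneg _)]

/-- Given the hidden chain, the event times have the density `eventDensity`. -/
theorem IsMMHP.lintegral_eventTimes [IsProbabilityMeasure P] (hN : IsMMHP θ P S Y W T) (n : ℕ)
    {F : ((ℕ → Fin M) × (ℕ → ℝ≥0∞)) × (Fin n → ℝ) → ℝ≥0∞} (hF : Measurable F) :
    ∫⁻ ω in {ω | T n ω < ∞}, F (chainOf Y W ω, eventTimes T n ω) ∂P =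
      ∫⁻ ω, (∫⁻ t, F (chainOf Y W ω, t) *
        θ.eventDensity (pathState (chainOf Y W ω)) n t) ∂P := by
  have hX := hN.chain.measurable_chainOf
  induction n with
  | zero =>
    have h1 : {ω | T 0 ω < ∞} = Set.univ := by ext ω; simp [hN.T_zero]
    rw [h1, Measure.restrict_univ]
    refine lintegral_congr fun ω => ?_
    rw [volume_pi, Measure.pi_of_empty _ (eventTimes T 0 ω), lintegral_dirac]
    simp [Params.eventDensity]
  | succ n ih =>
    have hH : Measurable fun ω => (chainOf Y W ω, eventTimes T n ω) :=
      hX.prodMk (hN.measurable_eventTimes n)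
    let rate : (((ℕ → Fin M) × (ℕ → ℝ≥0∞)) × (Fin n → ℝ)) × ℝ → ℝ := fun p =>
      θ.intensity (pathState p.1.1) p.1.2 (endTime p.1.2 + p.2)
    have hend : Measurable fun p : (((ℕ → Fin M) × (ℕ → ℝ≥0∞)) × (Fin n → ℝ)) × ℝ =>
      endTime p.1.2 := measurable_endTime.comp (by fun_prop)
    have hrate : Measurable rate := (θ.measurable_intensity measurable_pathState).comp
      (f := fun p : (((ℕ → Fin M) × (ℕ → ℝ≥0∞)) × (Fin n → ℝ)) × ℝ =>
        (p.1, endTime p.1.2 + p.2)) (measurable_fst.prodMk (hend.add measurable_snd))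
    have hsnoc : Measurable fun p : (((ℕ → Fin M) × (ℕ → ℝ≥0∞)) × (Fin n → ℝ)) × ℝ =>
        (p.1.1, (Fin.snoc p.1.2 p.2 : Fin (n + 1) → ℝ)) := by
      refine (measurable_fst.comp measurable_fst).prodMk (measurable_pi_lambda _ fun k => ?_)
      refine Fin.lastCases ?_ (fun k => ?_) k
      · simpa using measurable_snd
      · simp only [Fin.snoc_castSucc]
        fun_prop
    -- The waiting time after the `n`-th event, and the function to integrate in terms of it.
    have hwait := lintegral_of_hazard (P := P) hH
      (A := {ω | T n ω < ∞}) (measurableSet_lt (hN.measurable_T n) measurable_const)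
      (V := fun ω => T (n + 1) ω - T n ω) ((hN.measurable_T _).sub (hN.measurable_T n)) hrate
      (fun e x _ => by simp only [rate, θ.intensity_eq]; exact θ.stateIntensity_nonneg _ _ _)
      (fun e b => by
        have := (θ.intervalIntegrable_intensity (measurable_pathState_right e.1) e.2
          (endTime e.2 + 0) (endTime e.2 + b)).comp_add_left (endTime e.2) enorm_ne_top
        simpa using this)
      (fun B hB x => hN.measure_waiting n hB x)
      (F := fun p => F (p.1.1, (Fin.snoc p.1.2 (endTime p.1.2 + p.2) : Fin (n + 1) → ℝ)))
      (hF.comp (hsnoc.comp (f := fun p : (((ℕ → Fin M) × (ℕ → ℝ≥0∞)) × (Fin n → ℝ)) × ℝ =>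
        (p.1, endTime p.1.2 + p.2)) (measurable_fst.prodMk (hend.add measurable_snd))))
    have hleft : ∫⁻ ω in {ω | T (n + 1) ω < ∞}, F (chainOf Y W ω, eventTimes T (n + 1) ω) ∂P =
        ∫⁻ ω in {ω | T n ω < ∞} ∩ {ω | T (n + 1) ω - T n ω < ∞},
          F (chainOf Y W ω, (Fin.snoc (eventTimes T n ω)
            (endTime (eventTimes T n ω) + (T (n + 1) ω - T n ω).toReal) : Fin (n + 1) → ℝ)) ∂P := by
      have hsets : {ω | T (n + 1) ω < ∞} =ᵐ[P]
          ({ω | T n ω < ∞} ∩ {ω | T (n + 1) ω - T n ω < ∞} : Set Ω) := by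
        refine Filter.eventuallyEq_set.mpr ?_
        filter_upwards [hN.T_increasing] with ω hω
        simp only [Set.mem_inter_iff, Set.mem_ofPred_eq]
        constructor
        · exact fun h => ⟨(hω n).1.trans_lt h, tsub_le_self.trans_lt h⟩
        · rintro ⟨h₁, h₂⟩
          exact (le_add_tsub (a := T (n + 1) ω) (b := T n ω)).trans_lt
            (ENNReal.add_lt_top.mpr ⟨h₁, h₂⟩)
      rw [Measure.restrict_congr_set hsets]
      have hm : MeasurableSet ({ω | T n ω < ∞} ∩ {ω | T (n + 1) ω - T n ω < ∞}) :=
        (measurableSet_lt (hN.measurable_T n) measurable_const).inter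
          (measurableSet_lt ((hN.measurable_T _).sub (hN.measurable_T n)) measurable_const)
      refine setLIntegral_congr_fun_ae hm ?_
      filter_upwards [hN.T_increasing] with ω hω hωm
      congr 2
      funext k
      refine Fin.lastCases ?_ (fun k => ?_) k
      · rw [Fin.snoc_last (α := fun _ => ℝ), ← hN.toReal_T_eq_endTime,
          ← ENNReal.toReal_add hωm.1.ne hωm.2.ne, add_tsub_cancel_of_le (hω n).1]
        rfl
      · rw [Fin.snoc_castSucc (α := fun _ => ℝ)]
        rfl
    -- The integral over the next event time, as a function of the past.
    let Φ : ((ℕ → Fin M) × (ℕ → ℝ≥0∞)) × (Fin n → ℝ) → ℝ≥0∞ := fun z =>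
      ∫⁻ v, F (z.1, (Fin.snoc z.2 v : Fin (n + 1) → ℝ)) * θ.nextDensity (pathState z.1) z.2 v
    have hint : Measurable fun p : (((ℕ → Fin M) × (ℕ → ℝ≥0∞)) × (Fin n → ℝ)) × ℝ =>
        F (p.1.1, (Fin.snoc p.1.2 p.2 : Fin (n + 1) → ℝ)) *
          θ.nextDensity (pathState p.1.1) p.1.2 p.2 :=
      (hF.comp hsnoc).mul (θ.measurable_nextDensity measurable_pathState)
    have hΦ : Measurable Φ := hint.lintegral_prod_right'
    have hright : ∀ z : ((ℕ → Fin M) × (ℕ → ℝ≥0∞)) × (Fin n → ℝ),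
        ∫⁻ v in Set.Ioi (0 : ℝ), F (z.1, (Fin.snoc z.2 (endTime z.2 + v) : Fin (n + 1) → ℝ)) *
          ENNReal.ofReal (rate (z, v) * Real.exp (-∫ y in (0 : ℝ)..v, rate (z, y))) = Φ z := by
      intro z
      simp only [Φ]
      rw [← lintegral_add_left_eq_self (fun v => F (z.1, (Fin.snoc z.2 v : Fin (n + 1) → ℝ)) *
        θ.nextDensity (pathState z.1) z.2 v) (endTime z.2), ← lintegral_indicator measurableSet_Ioi]
      refine lintegral_congr fun v => ?_
      simp only [rate]
      by_cases hv : 0 < v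
      · simp [Params.nextDensity, hv]
      · simp [Params.nextDensity, hv]
    rw [hleft, hwait]
    simp_rw [hright (_, _)]
    rw [ih hΦ]
    refine lintegral_congr fun ω => ?_
    have hm1 : Measurable fun t : Fin (n + 1) → ℝ => F (chainOf Y W ω, t) *
        θ.eventDensity (pathState (chainOf Y W ω)) (n + 1) t :=
      (hF.comp measurable_prodMk_left).mul
        ((θ.measurable_eventDensity measurable_pathState (n + 1)).comp measurable_prodMk_left)
    rw [volume_pi, volume_pi, lintegral_pi_snoc _ hm1]
    refine lintegral_congr fun t => ?_
    have hm2 : Measurable fun v => F (chainOf Y W ω, (Fin.snoc t v : Fin (n + 1) → ℝ)) *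
          θ.nextDensity (pathState (chainOf Y W ω)) t v :=
      hint.comp (f := fun v => ((chainOf Y W ω, t), v)) measurable_prodMk_left
    simp only [Φ]
    rw [← lintegral_mul_const _ hm2]
    refine lintegral_congr fun v => ?_
    rw [Params.eventDensity, Fin.init_snoc, Fin.snoc_last]
    ring

end EventLaw

/-! ### Countable disjoint unions of measure spaces -/

section DisjointUnion

variable {β : ℕ → Type*} [∀ n, MeasurableSpace (β n)]

theorem measurableEmbedding_sigmaMk (n : ℕ) :
    MeasurableEmbedding (Sigma.mk n : β n → Σ n, β n) where
  injective := sigma_mk_injective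
  measurable := measurable_sigmaMk n
  measurableSet_image' := fun s hs => by
    refine MeasurableSpace.measurableSet_iInf.mpr fun k => ?_
    change MeasurableSet (Sigma.mk k ⁻¹' (Sigma.mk n '' s))
    by_cases h : n = k
    · subst h
      rwa [Set.preimage_image_eq _ sigma_mk_injective]
    · rw [Set.preimage_image_sigmaMk_of_ne (Ne.symm h)]
      exact MeasurableSet.empty

/-- Measurability on the product with a countable disjoint union may be checked on each summand. -/
theorem measurable_sigma_prod {α γ : Type*} [MeasurableSpace α] [MeasurableSpace γ]
    {f : (Σ n, β n) × γ → α} (hf : ∀ n, Measurable fun p : β n × γ => f (⟨n, p.1⟩, p.2)) :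
    Measurable f := by
  intro B hB
  have : f ⁻¹' B = ⋃ n, Prod.map (Sigma.mk n) id ''
      ((fun p : β n × γ => f (⟨n, p.1⟩, p.2)) ⁻¹' B) := by
    ext ⟨⟨n, x⟩, c⟩
    simp only [Set.mem_preimage, Set.mem_iUnion, Set.mem_image, Prod.exists, Prod.map_apply, id,
      Prod.mk.injEq]
    constructor
    · exact fun h => ⟨n, x, c, h, rfl, rfl⟩
    · rintro ⟨k, y, d, h, h', rfl⟩
      rwa [h'] at h
  rw [this]
  exact MeasurableSet.iUnion fun n =>
    ((measurableEmbedding_sigmaMk n).prodMap MeasurableEmbedding.id).measurableSet_image.mpr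
      (hf n hB)

theorem sigmaFinite_sum_map_sigmaMk (ν : ∀ n, Measure (β n)) [∀ n, SigmaFinite (ν n)] :
    SigmaFinite (Measure.sum fun n => (ν n).map (Sigma.mk n : β n → Σ n, β n)) := by
  -- Sets of finite measure that meet only finitely many summands.
  let s : ℕ → Set (Σ n, β n) := fun N => {h | h.1 ≤ N ∧ h.2 ∈ spanningSets (ν h.1) N}
  have hpre : ∀ N n, Sigma.mk n ⁻¹' s N = if n ≤ N then spanningSets (ν n) N else ∅ := by
    intro N n
    ext x
    by_cases h : n ≤ N <;> simp [s, h]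
  have hs : ∀ N, MeasurableSet (s N) := fun N => by
    refine MeasurableSpace.measurableSet_iInf.mpr fun n => ?_
    change MeasurableSet (Sigma.mk n ⁻¹' s N)
    rw [hpre]
    split_ifs
    exacts [measurableSet_spanningSets _ _, MeasurableSet.empty]
  refine ⟨⟨⟨s, fun _ => trivial, fun N => ?_, ?_⟩⟩⟩
  · rw [Measure.sum_apply _ (hs N), tsum_eq_sum (s := Finset.range (N + 1))]
    · refine ENNReal.sum_lt_top.mpr fun n _ => ?_
      rw [Measure.map_apply (measurable_sigmaMk n) (hs N), hpre]
      split_ifs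
      · exact measure_spanningSets_lt_top _ _
      · simp
    · intro n hn
      rw [Measure.map_apply (measurable_sigmaMk n) (hs N), hpre, if_neg, measure_empty]
      simpa using hn
  · refine Set.eq_univ_of_forall fun ⟨n, x⟩ => Set.mem_iUnion.mpr ?_
    have hx : x ∈ ⋃ N, spanningSets (ν n) N := by rw [iUnion_spanningSets]; trivial
    obtain ⟨N, hN⟩ := Set.mem_iUnion.mp hx
    exact ⟨max n N, le_max_left _ _, monotone_spanningSets (ν n) (le_max_right _ _) hN⟩

end DisjointUnion

/-! ### The density of the complete data -/

section Density

variable {M K : ℕ}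

/-- The state at time `x` of a hidden path, that is, `CompleteData.state` with no event times, as
these play no role there. -/
noncomputable def stateOf (h : HiddenPath M) (x : ℝ) : Fin M :=
  CompleteData.state (K := 0) (h, Fin.elim0) x

theorem measurable_stateOf : Measurable fun p : HiddenPath M × ℝ => stateOf p.1 p.2 := by
  refine measurable_sigma_prod fun m => ?_
  let N : ((Fin (m + 1) → Fin M) × (Fin m → ℝ)) × ℝ → ℕ := fun p =>
    ∑ k : Fin m, if p.1.2 k ≤ p.2 then 1 else 0
  have hN : Measurable N := Finset.measurable_fun_sum _ fun k _ =>
    Measurable.ite (measurableSet_le (by fun_prop) measurable_snd) measurable_const measurable_const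
  have hNcard : ∀ p : ((Fin (m + 1) → Fin M) × (Fin m → ℝ)) × ℝ,
      CompleteData.jumpsUpTo (K := 0) (⟨m, p.1⟩, Fin.elim0) p.2 = N p := by
    intro p
    have : {k : Fin m | p.1.2 k ≤ p.2} =
        ((Finset.univ.filter fun k : Fin m => p.1.2 k ≤ p.2 : Finset (Fin m)) : Set (Fin m)) := by
      ext; simp
    change {k : Fin m | p.1.2 k ≤ p.2}.ncard = _
    rw [this, Set.ncard_coe_finset, Finset.card_filter]
  refine measurable_to_countable' fun i => ?_
  have : (fun p : ((Fin (m + 1) → Fin M) × (Fin m → ℝ)) × ℝ =>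
      stateOf (⟨m, p.1⟩ : HiddenPath M) p.2) ⁻¹' {i} =
      ⋃ k : Fin (m + 1), {p | N p = k} ∩ {p | p.1.1 k = i} := by
    ext p
    have hlt : N p < m + 1 := by
      rw [← hNcard]
      exact CompleteData.jumpsUpTo_lt _ _
    have hst : stateOf (⟨m, p.1⟩ : HiddenPath M) p.2 = p.1.1 ⟨N p, hlt⟩ := by
      exact congrArg p.1.1 (Fin.ext (hNcard p))
    simp only [Set.mem_preimage, Set.mem_singleton_iff, hst, Set.mem_iUnion, Set.mem_inter_iff,
      Set.mem_ofPred_eq]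
    constructor
    · exact fun h => ⟨⟨N p, hlt⟩, rfl, h⟩
    · rintro ⟨k, hk, h⟩
      rwa [show (⟨N p, hlt⟩ : Fin (m + 1)) = k from Fin.ext hk]
  rw [this]
  have hs : ∀ k : Fin (m + 1), Measurable fun p : ((Fin (m + 1) → Fin M) × (Fin m → ℝ)) × ℝ =>
      p.1.1 k := fun k => by fun_prop
  exact MeasurableSet.iUnion fun k =>
    (hN (measurableSet_singleton _)).inter (hs k (measurableSet_singleton i))

theorem measurable_stateOf_right (h : HiddenPath M) : Measurable (stateOf h) :=
  measurable_stateOf.comp measurable_prodMk_left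

theorem measurable_snoc_apply {m : ℕ} (p : Fin (m + 1)) :
    Measurable fun z : (Fin m → ℝ) × ℝ => (Fin.snoc z.1 z.2 : Fin (m + 1) → ℝ) p := by
  refine Fin.lastCases ?_ (fun k => ?_) p
  · simpa using measurable_snd
  · simp only [Fin.snoc_castSucc]
    fun_prop

theorem Params.measurable_chainDensity (θ : Params M) :
    Measurable fun p : HiddenPath M × ℝ => θ.chainDensity p.1 p.2 := by
  refine measurable_sigma_prod fun m => ?_
  have hfin : ∀ g : (Fin (m + 1) → Fin M) → ℝ,
      Measurable fun p : ((Fin (m + 1) → Fin M) × (Fin m → ℝ)) × ℝ => g p.1.1 := fun g =>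
    (measurable_of_countable g).comp (measurable_fst.comp measurable_fst)
  have hQ : Measurable fun p : ((Fin (m + 1) → Fin M) × (Fin m → ℝ)) × ℝ =>
      ∏ k : Fin m, ENNReal.ofReal (θ.Q (p.1.1 k.castSucc) (p.1.1 k.succ)) :=
    Finset.measurable_fun_prod _ fun k _ =>
      (hfin fun s => θ.Q (s k.castSucc) (s k.succ)).ennreal_ofReal
  have hq : Measurable fun p : ((Fin (m + 1) → Fin M) × (Fin m → ℝ)) × ℝ =>
      ∑ k : Fin (m + 1), θ.q (p.1.1 k) * ((Fin.snoc p.1.2 p.2 : Fin (m + 1) → ℝ) k -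
        (Fin.cons 0 p.1.2 : Fin (m + 1) → ℝ) k) :=
    Finset.measurable_fun_sum _ fun k _ =>
      (hfin fun s => θ.q (s k)).mul (((measurable_snoc_apply k).comp
        (f := fun p : ((Fin (m + 1) → Fin M) × (Fin m → ℝ)) × ℝ => (p.1.2, p.2)) (by fun_prop)).sub
        ((measurable_cons_apply k).comp (measurable_snd.comp measurable_fst)))
  exact ((hfin fun s => θ.ξ (s 0)).ennreal_ofReal.mul hQ).mul hq.neg.exp.ennreal_ofReal

theorem measurableSet_pathValid :
    MeasurableSet {p : HiddenPath M × ℝ | PathValid p.1 p.2} := by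
  have h : Measurable fun p : HiddenPath M × ℝ => PathValid p.1 p.2 := by
    refine measurable_sigma_prod fun m => ?_
    refine measurableSet_setOfPred.mp ?_
    have hset : {p : ((Fin (m + 1) → Fin M) × (Fin m → ℝ)) × ℝ |
        PathValid (⟨m, p.1⟩ : HiddenPath M) p.2} =
        (⋂ k, {p | 0 < p.1.2 k} ∩ {p | p.1.2 k < p.2}) ∩
          ((⋂ (j) (k) (_ : j < k), {p | p.1.2 j < p.1.2 k}) ∩
            ⋂ k : Fin m, {p | p.1.1 k.castSucc ≠ p.1.1 k.succ}) := by
      ext p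
      simp [PathValid, StrictMono]
    rw [hset]
    refine (MeasurableSet.iInter fun k => ?_).inter
      ((MeasurableSet.iInter fun j => MeasurableSet.iInter fun k => MeasurableSet.iInter
        fun _ => ?_).inter (MeasurableSet.iInter fun k => ?_))
    · exact (measurableSet_lt measurable_const (by fun_prop)).inter
        (measurableSet_lt (by fun_prop) measurable_snd)
    · exact measurableSet_lt (by fun_prop) (by fun_prop)
    · exact (measurableSet_eq_fun (by fun_prop) (by fun_prop)).compl
  exact measurableSet_setOfPred.mpr h

theorem measurableSet_timesValid {n : ℕ} : MeasurableSet {t : Fin n → ℝ | TimesValid t} := by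
  have hset : {t : Fin n → ℝ | TimesValid t} =
      (⋂ k, {t | 0 < t k}) ∩ ⋂ (j) (k) (_ : j < k), {t | t j < t k} := by
    ext t
    simp [TimesValid, StrictMono]
  rw [hset]
  exact (MeasurableSet.iInter fun k => measurableSet_lt measurable_const (by fun_prop)).inter
    (MeasurableSet.iInter fun j => MeasurableSet.iInter fun k => MeasurableSet.iInter
        fun _ => measurableSet_lt (by fun_prop) (by fun_prop))

theorem CompleteData.valid_iff (c : CompleteData M K) :
    c.Valid ↔ TimesValid c.t ∧ PathValid c.1 (endTime c.t) := by
  rw [← c.horizon_eq, CompleteData.Valid, TimesValid, PathValid, and_assoc]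

theorem measurableSet_valid : MeasurableSet {c : CompleteData M K | c.Valid} := by
  have hset : {c : CompleteData M K | c.Valid} =
      Prod.snd ⁻¹' {t | TimesValid t} ∩
        (fun c : CompleteData M K => (c.1, endTime c.2)) ⁻¹' {p | PathValid p.1 p.2} := by
    ext c
    exact c.valid_iff
  rw [hset]
  exact (measurable_snd measurableSet_timesValid).inter
    ((measurable_fst.prodMk (measurable_endTime.comp measurable_snd)) measurableSet_pathValid)

/-- The density of the complete data with respect to the reference measure. -/
noncomputable def Params.completeDensity (θ : Params M) (c : CompleteData M K) : ℝ≥0∞ :=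
  θ.chainDensity c.1 (endTime c.t) * θ.eventDensity (stateOf c.1) K c.t

theorem Params.measurable_completeDensity (θ : Params M) :
    Measurable (θ.completeDensity : CompleteData M K → ℝ≥0∞) :=
  (θ.measurable_chainDensity.comp (measurable_fst.prodMk (measurable_endTime.comp
    measurable_snd))).mul (θ.measurable_eventDensity measurable_stateOf K)

instance : SigmaFinite (referenceMeasure M K) := by
  have := sigmaFinite_sum_map_sigmaMk fun m : ℕ =>
    (Measure.count : Measure (Fin (m + 1) → Fin M)).prod (volume : Measure (Fin m → ℝ))
  unfold referenceMeasure
  infer_instance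

/-- The reference measure integrates over the event times, the number of jumps, the states and the
jump times of the valid data. -/
theorem lintegral_referenceMeasure {F : CompleteData M K → ℝ≥0∞} (hF : Measurable F) :
    ∫⁻ c, F c ∂referenceMeasure M K =
      ∫⁻ t : Fin K → ℝ, ∑' m : ℕ, ∑ i : Fin (m + 1) → Fin M, ∫⁻ u : Fin m → ℝ,
        {c : CompleteData M K | c.Valid}.indicator F (⟨m, i, u⟩, t) := by
  have hFv := hF.indicator (measurableSet_valid (M := M) (K := K))
  have := sigmaFinite_sum_map_sigmaMk fun m : ℕ =>
    (Measure.count : Measure (Fin (m + 1) → Fin M)).prod (volume : Measure (Fin m → ℝ))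
  rw [referenceMeasure, ← lintegral_indicator measurableSet_valid,
    lintegral_prod_symm _ hFv.aemeasurable]
  refine lintegral_congr fun t => ?_
  rw [lintegral_sum_measure]
  refine tsum_congr fun m => ?_
  have h1 : Measurable fun h : HiddenPath M =>
      {c : CompleteData M K | c.Valid}.indicator F (h, t) := hFv.comp measurable_prodMk_right
  have h2 : Measurable fun z : (Fin (m + 1) → Fin M) × (Fin m → ℝ) =>
      {c : CompleteData M K | c.Valid}.indicator F (⟨m, z⟩, t) := h1.comp (measurable_sigmaMk m)
  rw [lintegral_map h1 (measurable_sigmaMk m), lintegral_prod _ h2.aemeasurable, lintegral_count,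
    tsum_fintype]

end Density

/-! ### The law of the complete data -/

section CompleteLaw

theorem completeData_eq {M K : ℕ} {Ω : Type*} (Y : ℕ → Ω → Fin M) (W T : ℕ → Ω → ℝ≥0∞) (ω : Ω) :
    completeData K Y W T ω =
      (pathUpTo (chainOf Y W ω).1 (chainOf Y W ω).2 (T K ω), eventTimes T K ω) := rfl

variable {M K : ℕ} {Ω : Type*} [MeasurableSpace Ω] {θ : Params M} {P : Measure Ω}
  {S : ℝ → Ω → Fin M} {Y : ℕ → Ω → Fin M} {W T : ℕ → Ω → ℝ≥0∞}

/-- The density of the event times only depends on the path up to the last event. -/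
theorem Params.eventDensity_congr (θ : Params M) {s s' : ℝ → Fin M} (hs : Measurable s)
    (hs' : Measurable s') {n : ℕ} {t : Fin n → ℝ}
    (h : ∀ x, 0 ≤ x → x ≤ endTime t → s x = s' x) :
    θ.eventDensity s n t = θ.eventDensity s' n t := by
  by_cases ht : TimesValid t
  · rw [θ.eventDensity_eq hs ht, θ.eventDensity_eq hs' ht]
    congr 1
    · exact Finset.prod_congr rfl fun k _ => by rw [h _ (ht.1 k).le (ht.le_endTime k)]
    · congr 3
      refine intervalIntegral.integral_congr fun y hy => ?_
      rw [Set.uIcc_of_le ht.endTime_nonneg] at hy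
      simp only [θ.intensity_eq, h y hy.1 hy.2]
  · rw [θ.eventDensity_of_not_valid s ht, θ.eventDensity_of_not_valid s' ht]

/-- Cutting a path at time `τ` does not change its states up to time `τ`. -/
theorem stateOf_pathUpTo {y : ℕ → Fin M} {w : ℕ → ℝ≥0∞} (hw : NonExplosive w) {x τ : ℝ}
    (hx : 0 ≤ x) (hxτ : x ≤ τ) :
    stateOf (pathUpTo y w (ENNReal.ofReal τ)) x = pathState (y, w) x := by
  obtain ⟨h₁, h₂⟩ := hw.jumpCount_spec (ENNReal.ofReal_ne_top (r := τ))
  obtain ⟨h₃, h₄⟩ := hw.jumpCount_spec (ENNReal.ofReal_ne_top (r := x))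
  have hle : jumpCount w (ENNReal.ofReal x) ≤ jumpCount w (ENNReal.ofReal τ) := by
    by_contra hlt
    have h5 := arrival_mono w (show jumpCount w (ENNReal.ofReal τ) + 1 ≤
      jumpCount w (ENNReal.ofReal x) by omega)
    exact absurd ((h₂.trans_le h5).trans_le h₃)
      (not_lt.mpr (ENNReal.ofReal_le_ofReal hxτ))
  have hj : CompleteData.jumpsUpTo (K := 0) (pathUpTo y w (ENNReal.ofReal τ), Fin.elim0) x =
      jumpCount w (ENNReal.ofReal x) := by
    refine CompleteData.jumpsUpTo_eq _ hle (fun k hk => ?_) (fun k hk => ?_)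
    · exact ENNReal.toReal_le_of_le_ofReal hx ((arrival_mono w hk).trans h₃)
    · have hfin : arrival w (k + 1) ≠ ∞ :=
        ne_top_of_le_ne_top ENNReal.ofReal_ne_top ((arrival_mono w k.2).trans h₁)
      exact (ENNReal.ofReal_lt_iff_lt_toReal hx hfin).mp
        (h₄.trans_le (arrival_mono w (Nat.succ_le_succ hk)))
  change y (CompleteData.jumpsUpTo (K := 0) (pathUpTo y w (ENNReal.ofReal τ), Fin.elim0) x) = _
  rw [hj]
  rfl

theorem IsMMHP.measurable_completeData (hN : IsMMHP θ P S Y W T) :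
    Measurable (completeData K Y W T) :=
  (measurable_pathUpTo.comp (hN.chain.measurable_chainOf.prodMk (hN.measurable_T K))).prodMk
    (hN.measurable_eventTimes K)

/-- The law of the complete data has the density `completeDensity`. -/
theorem IsMMHP.completeLaw_eq [IsProbabilityMeasure P] (hN : IsMMHP θ P S Y W T) :
    completeLaw K P Y W T = (referenceMeasure M K).withDensity θ.completeDensity := by
  refine Measure.ext_of_lintegral _ fun F hF => ?_
  have hend : Measurable fun t : Fin K → ℝ => ENNReal.ofReal (endTime t) :=
    measurable_endTime.ennreal_ofReal
  have hpath : Measurable fun p : ((ℕ → Fin M) × (ℕ → ℝ≥0∞)) × (Fin K → ℝ) =>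
      pathUpTo p.1.1 p.1.2 (ENNReal.ofReal (endTime p.2)) :=
    measurable_pathUpTo.comp (f := fun p : ((ℕ → Fin M) × (ℕ → ℝ≥0∞)) × (Fin K → ℝ) =>
      (p.1, ENNReal.ofReal (endTime p.2))) (measurable_fst.prodMk (hend.comp measurable_snd))
  let G : HiddenPath M × (Fin K → ℝ) → ℝ≥0∞ := fun c => F c * θ.eventDensity (stateOf c.1) K c.2
  have hG : Measurable G := hF.mul (θ.measurable_eventDensity measurable_stateOf K)
  have hX := hN.chain.measurable_chainOf
  -- The density of the event times given the whole chain only sees the chain up to the last event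
  -- time `t_K`, so that, `t` being fixed, the chain can be integrated out up to the time `t_K`.
  calc ∫⁻ c, F c ∂completeLaw K P Y W T
      = ∫⁻ ω in {ω | T K ω < ∞}, F (pathUpTo (chainOf Y W ω).1 (chainOf Y W ω).2
          (ENNReal.ofReal (endTime (eventTimes T K ω))), eventTimes T K ω) ∂P := by
        rw [completeLaw, lintegral_map hF hN.measurable_completeData]
        refine setLIntegral_congr_fun (measurableSet_lt (hN.measurable_T K) measurable_const)
          fun ω hω => ?_
        simp only [← hN.toReal_T_eq_endTime]
        rw [ENNReal.ofReal_toReal (ne_of_lt hω), completeData_eq]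
    _ = ∫⁻ ω, (∫⁻ t : Fin K → ℝ, F (pathUpTo (chainOf Y W ω).1 (chainOf Y W ω).2
          (ENNReal.ofReal (endTime t)), t) *
            θ.eventDensity (pathState (chainOf Y W ω)) K t) ∂P :=
        hN.lintegral_eventTimes K (F := fun p => F (pathUpTo p.1.1 p.1.2
          (ENNReal.ofReal (endTime p.2)), p.2)) (hF.comp (hpath.prodMk measurable_snd))
    _ = ∫⁻ ω, (∫⁻ t : Fin K → ℝ, G (pathUpTo (chainOf Y W ω).1 (chainOf Y W ω).2
          (ENNReal.ofReal (endTime t)), t)) ∂P := by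
        refine lintegral_congr_ae ?_
        filter_upwards [hN.chain.ae_nonExplosive] with ω hω
        refine lintegral_congr fun t => ?_
        simp only [G]
        congr 1
        exact θ.eventDensity_congr (measurable_pathState_right _) (measurable_stateOf_right _)
          fun x hx hxt => (stateOf_pathUpTo hω hx hxt).symm
    _ = ∫⁻ t : Fin K → ℝ, ∫⁻ ω, G (pathUpTo (chainOf Y W ω).1 (chainOf Y W ω).2
          (ENNReal.ofReal (endTime t)), t) ∂P := by
        refine lintegral_lintegral_swap (Measurable.aemeasurable ?_)
        exact hG.comp ((hpath.comp ((hX.comp measurable_fst).prodMk measurable_snd)).prodMk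
          measurable_snd)
    _ = ∫⁻ t : Fin K → ℝ, ∑' m : ℕ, ∑ i : Fin (m + 1) → Fin M, ∫⁻ u : Fin m → ℝ,
          {c : CompleteData M K | c.Valid}.indicator (fun c => θ.completeDensity c * F c)
            (⟨m, i, u⟩, t) := by
        refine lintegral_congr fun t => ?_
        by_cases ht : TimesValid t
        · have hpt := hN.chain.lintegral_pathUpTo ht.endTime_nonneg (G := fun h => G (h, t))
            (hG.comp measurable_prodMk_right)
          refine hpt.trans (tsum_congr fun m => Finset.sum_congr rfl fun i _ =>
            lintegral_congr fun u => ?_)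
          have hv := CompleteData.valid_iff ((⟨m, i, u⟩, t) : CompleteData M K)
          by_cases hpv : PathValid (⟨m, i, u⟩ : HiddenPath M) (endTime t)
          · rw [Set.indicator_of_mem (show _ ∈ {h : HiddenPath M | PathValid h (endTime t)}
                from hpv),
              Set.indicator_of_mem (show _ ∈ {c : CompleteData M K | c.Valid} from
                hv.mpr ⟨ht, hpv⟩)]
            simp only [G, Params.completeDensity]
            ring
          · rw [Set.indicator_of_notMem (show _ ∉ {h : HiddenPath M | PathValid h (endTime t)}
                from hpv),
              Set.indicator_of_notMem (show _ ∉ {c : CompleteData M K | c.Valid} from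
                fun h => hpv (hv.mp h).2)]
        · have hzero : ∀ m i u, {c : CompleteData M K | c.Valid}.indicator
              (fun c => θ.completeDensity c * F c) ((⟨m, i, u⟩, t) : CompleteData M K) = 0 :=
            fun m i u => Set.indicator_of_notMem
              (show ((⟨m, i, u⟩, t) : CompleteData M K) ∉ {c : CompleteData M K | c.Valid} from
                fun h => ht ((CompleteData.valid_iff _).mp h).1) _
          simp [G, θ.eventDensity_of_not_valid _ ht, hzero]
    _ = ∫⁻ c, F c ∂(referenceMeasure M K).withDensity θ.completeDensity := by
        rw [lintegral_withDensity_eq_lintegral_mul _ θ.measurable_completeDensity hF,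
          lintegral_referenceMeasure (θ.measurable_completeDensity.mul hF)]
        rfl

end CompleteLaw

/-! ### The logarithm of the density -/

section LogLikelihood

/-- No factor needs to be positive or finite: `log 0 = ⊥` absorbs all other summands, as `0` absorbs
all other factors. -/
theorem log_prod {ι : Type*} (s : Finset ι) (f : ι → ℝ≥0∞) :
    ENNReal.log (∏ k ∈ s, f k) = ∑ k ∈ s, ENNReal.log (f k) := by
  classical
  induction s using Finset.induction_on with
  | empty => simp
  | insert a s ha ih => rw [Finset.prod_insert ha, Finset.sum_insert ha, ENNReal.log_mul_add, ih]

theorem log_ofReal_exp (x : ℝ) : ENNReal.log (ENNReal.ofReal (Real.exp x)) = (x : EReal) := by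
  rw [ENNReal.log_ofReal_of_pos (Real.exp_pos x), Real.log_exp]

theorem ereal_coe_sum {ι : Type*} (s : Finset ι) (f : ι → ℝ) :
    ((∑ k ∈ s, f k : ℝ) : EReal) = ∑ k ∈ s, (f k : EReal) :=
  map_sum (⟨⟨Real.toEReal, EReal.coe_zero⟩, EReal.coe_add⟩ : ℝ →+ EReal) f s

theorem ereal_sum_sub_coe {ι : Type*} (s : Finset ι) (f : ι → EReal) (g : ι → ℝ) :
    ∑ k ∈ s, (f k - (g k : EReal)) = ∑ k ∈ s, f k + ((-∑ k ∈ s, g k : ℝ) : EReal) := by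
  rw [← Finset.sum_neg_distrib, ereal_coe_sum, ← Finset.sum_add_distrib]
  exact Finset.sum_congr rfl fun k _ => by rw [sub_eq_add_neg, EReal.coe_neg]

variable {M K : ℕ} (θ : Params M)

theorem CompleteData.Valid.state_zero {c : CompleteData M K} (hc : c.Valid) :
    c.state 0 = c.s 0 :=
  c.state_eq 0 (fun _ hk => absurd hk (Fin.not_lt_zero _)) fun k _ => (hc.2.2.1 k).1

/-- Summing over pairs of states with their numbers of transitions amounts to summing over jumps. -/
theorem CompleteData.Valid.sum_transitions {c : CompleteData M K} (hc : c.Valid)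
    (L : Fin M → Fin M → EReal) :
    ∑ i, ∑ j ∈ Finset.univ.erase i, ((c.transitions i j : ℝ) : EReal) * L i j =
      ∑ p : Fin c.m, L (c.s p.castSucc) (c.s p.succ) := by
  have h1 : ∀ i j, ((c.transitions i j : ℝ) : EReal) * L i j =
      ∑ p : Fin c.m, if c.s p.castSucc = i ∧ c.s p.succ = j then L i j else 0 := by
    intro i j
    rw [← Finset.sum_filter, Finset.sum_const, c.transitions_eq_card, EReal.nsmul_eq_mul]
    simp
  simp_rw [h1]
  calc ∑ i, ∑ j ∈ Finset.univ.erase i, ∑ p : Fin c.m,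
        (if c.s p.castSucc = i ∧ c.s p.succ = j then L i j else 0)
      = ∑ i, ∑ p : Fin c.m, ∑ j ∈ Finset.univ.erase i,
        (if c.s p.castSucc = i ∧ c.s p.succ = j then L i j else 0) :=
        Finset.sum_congr rfl fun i _ => Finset.sum_comm
    _ = ∑ p : Fin c.m, ∑ i, ∑ j ∈ Finset.univ.erase i,
        (if c.s p.castSucc = i ∧ c.s p.succ = j then L i j else 0) := Finset.sum_comm
    _ = ∑ p : Fin c.m, L (c.s p.castSucc) (c.s p.succ) := by
        refine Finset.sum_congr rfl fun p _ => ?_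
        rw [Finset.sum_eq_single (c.s p.castSucc), Finset.sum_eq_single (c.s p.succ)]
        · simp
        · intro j _ hj
          rw [if_neg fun h => hj h.2.symm]
        · exact fun h => absurd (Finset.mem_erase.mpr ⟨(hc.2.2.2.2 p).symm, Finset.mem_univ _⟩) h
        · intro i _ hi
          exact Finset.sum_eq_zero fun j _ => if_neg fun h => hi h.1.symm
        · simp

/-- Grouping the sojourns and the jumps of the path by states turns the logarithm of its density
into the Markov part of the log-likelihood. -/
theorem CompleteData.Valid.log_chainDensity {c : CompleteData M K} (hc : c.Valid) :
    ENNReal.log (θ.chainDensity c.1 (endTime c.t)) = logLikelihoodMarkov θ c := by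
  have hocc : ∑ i, c.occupation i * θ.q i = ∑ p : Fin (c.m + 1), θ.q (c.s p) *
      ((Fin.snoc c.u c.horizon : Fin (c.m + 1) → ℝ) p -
        (Fin.cons 0 c.u : Fin (c.m + 1) → ℝ) p) := by
    simp_rw [hc.occupation_eq, Finset.sum_mul]
    rw [Finset.sum_comm]
    refine Finset.sum_congr rfl fun p _ => ?_
    simp [mul_comm]
  rw [logLikelihoodMarkov, Finset.sum_add_distrib, ereal_sum_sub_coe, hocc,
    hc.sum_transitions fun i j => elog (θ.Q i j), Params.chainDensity, ENNReal.log_mul_add,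
    ENNReal.log_mul_add, log_prod, log_ofReal_exp, ← c.horizon_eq, Finset.sum_ite_eq,
    if_pos (Finset.mem_univ _), hc.state_zero, add_right_comm]
  rfl

/-- Splitting the intensity at each time by the current state turns the logarithm of the density of
the event times into the Hawkes part of the log-likelihood. -/
theorem CompleteData.Valid.log_eventDensity {c : CompleteData M K} (hc : c.Valid) :
    ENNReal.log (θ.eventDensity (stateOf c.1) K c.t) = logLikelihoodHawkes θ c := by
  have ht := (c.valid_iff.mp hc).1
  have hint : ∀ i, IntervalIntegrable
      (fun x => if c.state x = i then θ.stateIntensity c.t i x else 0) volume 0 c.horizon :=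
    fun i => θ.intervalIntegrable_stateIntensity_ite (measurable_stateOf_right c.1) c.t i 0 _
  rw [logLikelihoodHawkes, ereal_sum_sub_coe,
    ← intervalIntegral.integral_finsetSum fun i _ => hint i,
    Finset.sum_comm, θ.eventDensity_eq (measurable_stateOf_right c.1) ht, ENNReal.log_mul_add,
    log_prod, log_ofReal_exp, ← c.horizon_eq]
  congr 1
  refine Finset.sum_congr rfl fun n _ => ?_
  rw [Finset.sum_ite_eq, if_pos (Finset.mem_univ _)]
  rfl

theorem CompleteData.Valid.log_completeDensity {c : CompleteData M K} (hc : c.Valid) :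
    ENNReal.log (θ.completeDensity c) = logLikelihoodMarkov θ c + logLikelihoodHawkes θ c := by
  rw [Params.completeDensity, ENNReal.log_mul_add, hc.log_chainDensity, hc.log_eventDensity]

end LogLikelihood

end MMHP

theorem mainTheorem3 {M K : ℕ} (θ : MMHP.Params M) {Ω : Type*} [MeasurableSpace Ω]
    (P : Measure Ω) [IsProbabilityMeasure P] (S : ℝ → Ω → Fin M)
    (Y : ℕ → Ω → Fin M) (W T : ℕ → Ω → ℝ≥0∞) (hN : MMHP.IsMMHP θ P S Y W T) :
    -- the law of the complete data has a density, and its logarithm is the sum of the two parts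
    (MMHP.completeLaw K P Y W T ≪ MMHP.referenceMeasure M K ∧
      ∀ᵐ c ∂MMHP.referenceMeasure M K,
        MMHP.completeLogLikelihood P Y W T c =
          MMHP.logLikelihoodMarkov θ c + MMHP.logLikelihoodHawkes θ c) ∧
    -- the two expressions of the occupation times and of the numbers of transitions
    ∀ c : MMHP.CompleteData M K, c.Valid →
      (∀ i, c.occupation i = ∑ p : Fin (c.m + 1), if c.s p = i then
        (Fin.snoc c.u c.horizon : Fin (c.m + 1) → ℝ) p - (Fin.cons 0 c.u : Fin (c.m + 1) → ℝ) p
        else 0) ∧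
      ∀ i j, i ≠ j →
        Filter.Tendsto
          (fun Δ : ℝ => 1 / Δ * ∫ x in Δ..c.horizon,
            if c.state (x - Δ) = i ∧ c.state x = j then (1 : ℝ) else 0)
          (nhdsWithin 0 (Set.Ioi 0)) (nhds (c.transitions i j : ℝ)) := by
  refine ⟨⟨?_, ?_⟩, fun c hc => ⟨hc.occupation_eq, fun i j hij => hc.tendsto_transitions hij⟩⟩
  · rw [hN.completeLaw_eq]
    exact withDensity_absolutelyContinuous _ _
  · have hvalid : ∀ᵐ c ∂MMHP.referenceMeasure M K, c.Valid :=
      ae_restrict_mem MMHP.measurableSet_valid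
    filter_upwards [Measure.rnDeriv_withDensity (MMHP.referenceMeasure M K)
      θ.measurable_completeDensity, hvalid] with c hc hv
    rw [MMHP.completeLogLikelihood, hN.completeLaw_eq, hc, hv.log_completeDensity]
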